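/- Let $X$ be a compact Hausdorff space. A $C(X)$-algebra is a (not necessarily unital) $C^*$-algebra $A$ endowed with a unital $*$-homomorphism from $C(X)$ to the centre of the multiplier algebra $M(A)$. For $x\in X$, let $A_x = A/\overline{C_x(X)A}$ be the fibre at $x$, a $C^*$-algebra, where $C_x(X)=\{f\in C(X): f(x)=0\}$ and $\overline{C_x(X)A}$ is the closed linear span of the products $fa$ with $f\in C_x(X)$, $a\in A$; let $\sigma^x:A\to A_x$ be the quotient map. Let $A_1$ and $A_2$ be two $C(X)$-algebras with quotient maps $\sigma_i^x:A_i\to (A_i)_x$, and let $A_1\otimes_{alg}A_2$ be their algebraic tensor product over $\mathbb C$. Let $\mathcal J(A_1,A_2)$ be the involutive ideal of all $\alpha\in A_1\otimes_{alg}A_2$ such that $(\sigma_1^x\otimes\sigma_2^x)(\alpha)=0$ in $(A_1)_x\otimes_{alg}(A_2)_x$ for every $x\in X$. For $\alpha\in A_1\otimes_{alg}A_2$ put $$\|\alpha\|_m=\sup_{x\in X}\big\|(\sigma_1^x\otimes\sigma_2^x)(\alpha)\big\|_{\min},$$ where $\|\cdot\|_{\min}$ is the minimal (spatial) $C^*$-norm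 on $(A_1)_x\otimes_{alg}(A_2)_x$, that is, the supremum of $\|(\pi_1\otimes\pi_2)(\cdot)\|$ over all representations $\pi_i$ of $(A_i)_x$ on Hilbert spaces (and $\sup\emptyset=0$). Then $\|\cdot\|_m$ factors through the involutive algebra $(A_1\otimes_{alg}A_2)/\mathcal J(A_1,A_2)$, the induced function is a $C^*$-norm on it, and it is the smallest one: every $C^*$-norm $\|\cdot\|_\beta$ on $(A_1\otimes_{alg}A_2)/\mathcal J(A_1,A_2)$ satisfies $\|\alpha\|_m\le\|\alpha\|_\beta$ for all $\alpha$. (A $C^*$-norm is a submultiplicative norm with $\|a^*a\|=\|a\|^2$; completeness is not required.) -/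

import Mathlib

open scoped TensorProduct MultiplierAlgebra

noncomputable section

/-! ### Involutive ideals and their quotients -/

/-- A two-sided self-adjoint ideal of a (not necessarily unital) complex involutive algebra. -/
structure StarIdeal (D : Type*) [NonUnitalRing D] [StarRing D] [Module ℂ D] extends
    Submodule ℂ D where
  mul_mem_left' : ∀ (a : D) {b : D}, b ∈ carrier → a * b ∈ carrier
  mul_mem_right' : ∀ {a : D} (b : D), a ∈ carrier → a * b ∈ carrier
  star_mem' : ∀ {a : D}, a ∈ carrier → star a ∈ carrier

namespace StarIdeal

section Algebra

variable {D : Type*} [NonUnitalRing D] [StarRing D] [Module ℂ D]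

/-- The underlying vector space of the quotient of `D` by the ideal `I`. -/
def Quotient (I : StarIdeal D) : Type _ := D ⧸ I.toSubmodule

variable (I : StarIdeal D)

instance : AddCommGroup I.Quotient := inferInstanceAs (AddCommGroup (D ⧸ I.toSubmodule))
instance : Module ℂ I.Quotient := inferInstanceAs (Module ℂ (D ⧸ I.toSubmodule))

/-- The quotient map. -/
def proj : D →ₗ[ℂ] I.Quotient := I.toSubmodule.mkQ

lemma proj_surjective : Function.Surjective I.proj := I.toSubmodule.mkQ_surjective

lemma proj_eq_proj {a b : D} : I.proj a = I.proj b ↔ a - b ∈ I.toSubmodule :=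
  Submodule.Quotient.eq I.toSubmodule

instance : Mul I.Quotient where
  mul := Quotient.map₂ (· * ·) fun a a' ha b b' hb => by
    have ha' := (Submodule.quotientRel_def _).1 ha
    have hb' := (Submodule.quotientRel_def _).1 hb
    refine (Submodule.quotientRel_def _).2 ?_
    have h := I.toSubmodule.add_mem (I.mul_mem_right' b ha') (I.mul_mem_left' a' hb')
    have e : a * b - a' * b' = (a - a') * b + a' * (b - b') := by noncomm_ring
    rw [e]; exact h

instance : Star I.Quotient where
  star := Quotient.map star fun a a' ha => by
    have ha' := (Submodule.quotientRel_def _).1 ha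
    refine (Submodule.quotientRel_def _).2 ?_
    rw [← star_sub]; exact I.star_mem' ha'

lemma proj_mul (a b : D) : I.proj (a * b) = I.proj a * I.proj b := rfl

lemma proj_star (a : D) : I.proj (star a) = star (I.proj a) := rfl

instance : NonUnitalRing I.Quotient where
  left_distrib x y z := by
    obtain ⟨a, rfl⟩ := I.proj_surjective x
    obtain ⟨b, rfl⟩ := I.proj_surjective y
    obtain ⟨c, rfl⟩ := I.proj_surjective z
    simp only [← map_add, ← proj_mul, mul_add]
  right_distrib x y z := by
    obtain ⟨a, rfl⟩ := I.proj_surjective x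
    obtain ⟨b, rfl⟩ := I.proj_surjective y
    obtain ⟨c, rfl⟩ := I.proj_surjective z
    simp only [← map_add, ← proj_mul, add_mul]
  zero_mul x := by
    obtain ⟨a, rfl⟩ := I.proj_surjective x
    rw [← map_zero I.proj, ← proj_mul, zero_mul]
  mul_zero x := by
    obtain ⟨a, rfl⟩ := I.proj_surjective x
    rw [← map_zero I.proj, ← proj_mul, mul_zero]
  mul_assoc x y z := by
    obtain ⟨a, rfl⟩ := I.proj_surjective x
    obtain ⟨b, rfl⟩ := I.proj_surjective y
    obtain ⟨c, rfl⟩ := I.proj_surjective z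
    simp only [← proj_mul, mul_assoc]

instance : StarRing I.Quotient where
  star_involutive x := by
    obtain ⟨a, rfl⟩ := I.proj_surjective x
    simp only [← proj_star, star_star]
  star_mul x y := by
    obtain ⟨a, rfl⟩ := I.proj_surjective x
    obtain ⟨b, rfl⟩ := I.proj_surjective y
    simp only [← proj_star, ← proj_mul, star_mul]
  star_add x y := by
    obtain ⟨a, rfl⟩ := I.proj_surjective x
    obtain ⟨b, rfl⟩ := I.proj_surjective y
    simp only [← proj_star, ← map_add, star_add]

instance [IsScalarTower ℂ D D] : IsScalarTower ℂ I.Quotient I.Quotient where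
  smul_assoc c x y := by
    obtain ⟨a, rfl⟩ := I.proj_surjective x
    obtain ⟨b, rfl⟩ := I.proj_surjective y
    simp only [smul_eq_mul, ← map_smul, ← proj_mul, smul_mul_assoc]

instance [SMulCommClass ℂ D D] : SMulCommClass ℂ I.Quotient I.Quotient where
  smul_comm c x y := by
    obtain ⟨a, rfl⟩ := I.proj_surjective x
    obtain ⟨b, rfl⟩ := I.proj_surjective y
    simp only [smul_eq_mul, ← map_smul, ← proj_mul, mul_smul_comm]

instance [StarModule ℂ D] : StarModule ℂ I.Quotient where
  star_smul c x := by
    obtain ⟨a, rfl⟩ := I.proj_surjective x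
    simp only [← map_smul, ← proj_star, star_smul]

end Algebra

end StarIdeal

/-! ### C*-norms on involutive algebras -/

section CStarNorm

variable {D : Type*} [NonUnitalRing D] [StarRing D] [Module ℂ D]

/-- A C*-semi-norm on a complex involutive algebra. -/
structure IsCStarSeminorm (p : Seminorm ℂ D) : Prop where
  mul_le : ∀ a b, p (a * b) ≤ p a * p b
  star_mul_self : ∀ a, p (star a * a) = p a ^ 2

/-- A C*-norm on a complex involutive algebra (completeness is not required). -/
structure IsCStarNorm (p : Seminorm ℂ D) : Prop extends IsCStarSeminorm p where
  eq_zero : ∀ a, p a = 0 → a = 0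

end CStarNorm

/-! ### The algebraic tensor product as an involutive algebra -/

section Tensor

variable {A B : Type*} [NonUnitalCStarAlgebra A] [NonUnitalCStarAlgebra B]

instance : StarRing (A ⊗[ℂ] B) where
  star_add := star_add
  star_mul x y := by
    induction x with
    | zero => simp
    | add x₁ x₂ h₁ h₂ => simp only [add_mul, mul_add, star_add, h₁, h₂]
    | tmul a b =>
      induction y with
      | zero => simp
      | add y₁ y₂ h₁ h₂ => simp only [add_mul, mul_add, star_add, h₁, h₂]
      | tmul c d => simp

end Tensor

/-! ### The minimal (spatial) C*-norm -/

/-- A representation of a C*-algebra on a Hilbert space. -/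
structure HilbertRep.{u} (A : Type u) [NonUnitalCStarAlgebra A] where
  /-- the Hilbert space -/
  H : Type u
  [normedAddCommGroup : NormedAddCommGroup H]
  [innerProductSpace : InnerProductSpace ℂ H]
  [completeSpace : CompleteSpace H]
  /-- the representation -/
  rep : A →⋆ₙₐ[ℂ] (H →L[ℂ] H)

attribute [instance] HilbertRep.normedAddCommGroup HilbertRep.innerProductSpace
  HilbertRep.completeSpace

section Spatial

variable {A B : Type*} [NonUnitalCStarAlgebra A] [NonUnitalCStarAlgebra B]

/-- The operator `(π₁ ⊗ π₂)(α)` on the algebraic tensor product `H₁ ⊗ H₂` with its inner product;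
it is bounded, and it has the same norm as its extension to the Hilbert space completion. -/
def HilbertRep.tensor (π₁ : HilbertRep A) (π₂ : HilbertRep B) :
    A ⊗[ℂ] B →ₗ[ℂ] (π₁.H ⊗[ℂ] π₂.H →L[ℂ] π₁.H ⊗[ℂ] π₂.H) :=
  TensorProduct.lift <| LinearMap.mk₂ ℂ
    (fun a b => TensorProduct.mapL (π₁.rep a) (π₂.rep b))
    (fun a a' b => by rw [map_add, TensorProduct.mapL_add_left])
    (fun c a b => by rw [map_smul, TensorProduct.mapL_smul_left])
    (fun a b b' => by rw [map_add, TensorProduct.mapL_add_right])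
    (fun c a b => by rw [map_smul, TensorProduct.mapL_smul_right])

/-- The minimal C*-norm on `A ⊗ B`: the supremum of `‖(π₁ ⊗ π₂)(α)‖` over all representations `π₁`
of `A` and `π₂` of `B`. -/
def minTensorNorm (α : A ⊗[ℂ] B) : ℝ :=
  ⨆ π : HilbertRep A × HilbertRep B, ‖π.1.tensor π.2 α‖

lemma exists_eq_sum_tmul (α : A ⊗[ℂ] B) :
    ∃ (n : ℕ) (a : Fin n → A) (b : Fin n → B), α = ∑ i, a i ⊗ₜ[ℂ] b i := by
  induction α with
  | zero => exact ⟨0, Fin.elim0, Fin.elim0, by simp⟩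
  | tmul a b => exact ⟨1, fun _ => a, fun _ => b, by simp⟩
  | add x y hx hy =>
    obtain ⟨n, a, b, rfl⟩ := hx
    obtain ⟨m, c, d, rfl⟩ := hy
    exact ⟨n + m, Fin.append a c, Fin.append b d, by simp [Fin.sum_univ_add]⟩

lemma HilbertRep.norm_tensor_le (π₁ : HilbertRep A) (π₂ : HilbertRep B) {n : ℕ} (a : Fin n → A)
    (b : Fin n → B) : ‖π₁.tensor π₂ (∑ i, a i ⊗ₜ[ℂ] b i)‖ ≤ ∑ i, ‖a i‖ * ‖b i‖ := by
  rw [map_sum]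
  refine norm_sum_le_of_le (E := π₁.H ⊗[ℂ] π₂.H →L[ℂ] π₁.H ⊗[ℂ] π₂.H) _ fun i _ => ?_
  refine (TensorProduct.norm_mapL_le (π₁.rep (a i)) (π₂.rep (b i))).trans ?_
  exact mul_le_mul (NonUnitalStarAlgHom.norm_apply_le _ _)
    (NonUnitalStarAlgHom.norm_apply_le _ _) (norm_nonneg _) (norm_nonneg _)

/-- The supremum defining the minimal C*-norm is a supremum of a bounded set. -/
lemma bddAbove_minTensorNorm (α : A ⊗[ℂ] B) :
    BddAbove (Set.range fun π : HilbertRep A × HilbertRep B => ‖π.1.tensor π.2 α‖) := by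
  obtain ⟨n, a, b, rfl⟩ := exists_eq_sum_tmul α
  refine ⟨∑ i, ‖a i‖ * ‖b i‖, ?_⟩
  rintro _ ⟨π, rfl⟩
  exact π.1.norm_tensor_le π.2 a b

end Spatial

/-! ### `C(X)`-algebras and their fibres -/

/-- A `C(X)`-algebra: a C*-algebra `A` with a unital morphism from `C(X)` to the centre of the
multiplier algebra of `A`. -/
class CXAlgebra (X : Type*) [TopologicalSpace X] [CompactSpace X] [T2Space X]
    (A : Type*) [NonUnitalCStarAlgebra A] where
  /-- the structure morphism -/
  toMultiplier : C(X, ℂ) →⋆ₐ[ℂ] 𝓜(ℂ, A)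
  mem_center : ∀ f, toMultiplier f ∈ Subalgebra.center ℂ 𝓜(ℂ, A)

namespace CXAlgebra

variable {X : Type*} [TopologicalSpace X] [CompactSpace X] [T2Space X]
variable {A : Type*} [NonUnitalCStarAlgebra A] [CXAlgebra X A]

/-- The product `f a` of a function `f` and an element `a`. -/
def act (f : C(X, ℂ)) : A →L[ℂ] A := (toMultiplier (A := A) f).fst

lemma act_mul_right (f : C(X, ℂ)) (a b : A) : act f (a * b) = a * act f b := by
  have h := (Subalgebra.mem_center_iff.1 (mem_center (A := A) f)) (a : 𝓜(ℂ, A))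
  have h' := congrArg (fun z : 𝓜(ℂ, A) => z.fst b) h
  simpa [act] using h'.symm

lemma eq_of_forall_mul_eq {a b : A} (h : ∀ c : A, c * a = c * b) : a = b := by
  rw [← sub_eq_zero, ← CStarRing.star_mul_self_eq_zero_iff, mul_sub, h, sub_self]

lemma act_mul_left (f : C(X, ℂ)) (a b : A) : act f (a * b) = act f a * b := by
  refine eq_of_forall_mul_eq fun c => ?_
  have h := (toMultiplier (A := A) f).central
  change c * (toMultiplier (A := A) f).fst (a * b) = c * ((toMultiplier (A := A) f).fst a * b)
  rw [← h, ← mul_assoc, ← mul_assoc, h]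

lemma snd_eq_act (f : C(X, ℂ)) (a : A) : (toMultiplier (A := A) f).snd a = act f a := by
  have h := (toMultiplier (A := A) f).central
  rw [← star_inj]
  refine eq_of_forall_mul_eq fun c => ?_
  rw [← star_inj, star_mul, star_mul, star_star, star_star, h, ← act_mul_left, act_mul_right]
  rfl

lemma star_act (f : C(X, ℂ)) (a : A) : star (act f a) = act (star f) (star a) := by
  have : act (star f) (star a) = (star (toMultiplier (A := A) f)).fst (star a) := by
    exact congrArg (fun z : 𝓜(ℂ, A) => z.fst (star a)) (map_star (toMultiplier (A := A)) f)
  rw [this, DoubleCentralizer.star_fst, star_star, snd_eq_act]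

lemma act_act (f g : C(X, ℂ)) (a : A) : act f (act g a) = act (f * g) a := by
  simp [act]

lemma act_sub_left (f g : C(X, ℂ)) (a : A) : act (f - g) a = act f a - act g a := by
  simp [act]

lemma act_one (a : A) : act (1 : C(X, ℂ)) a = a := by
  simp [act]

lemma norm_act_le (f : C(X, ℂ)) (a : A) : ‖act f a‖ ≤ ‖f‖ * ‖a‖ := by
  refine (ContinuousLinearMap.le_opNorm _ _).trans (mul_le_mul_of_nonneg_right ?_ (norm_nonneg _))
  rw [act, DoubleCentralizer.norm_fst]
  exact NonUnitalStarAlgHom.norm_apply_le _ _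

variable (A) in
/-- The products `f a` with `f` vanishing at `x`. -/
def vanishing (x : X) : Set A := {c | ∃ (f : C(X, ℂ)) (a : A), f x = 0 ∧ c = act f a}

lemma closure_span_induction {S : Set A} {P : A → Prop}
    (hP : IsClosed {a | P a}) (h0 : P 0) (hadd : ∀ a b, P a → P b → P (a + b))
    (hsmul : ∀ (c : ℂ) a, P a → P (c • a)) (hS : ∀ a ∈ S, P a) {a : A}
    (ha : a ∈ (Submodule.span ℂ S).topologicalClosure) : P a := by
  refine closure_minimal (fun b hb => ?_) hP ha
  exact Submodule.span_induction (p := fun b _ => P b) hS h0 (fun a b _ _ => hadd a b)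
    (fun c a _ => hsmul c a) hb

variable (A) in
/-- The closed ideal `C_x(X) A` of `A`, where `C_x(X)` are the functions vanishing at `x`. -/
def fibreIdeal (x : X) : StarIdeal A where
  toSubmodule := (Submodule.span ℂ (vanishing A x)).topologicalClosure
  mul_mem_left' a b hb := by
    set J := (Submodule.span ℂ (vanishing A x)).topologicalClosure with hJ
    have hc : IsClosed (J : Set A) := Submodule.isClosed_topologicalClosure _
    refine closure_span_induction (S := vanishing A x) (P := fun b => a * b ∈ J)
      (hc.preimage (continuous_const_mul a)) (by simp)
      (fun b c hb hc => by rw [mul_add]; exact J.add_mem hb hc)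
      (fun t b hb => by rw [mul_smul_comm]; exact J.smul_mem t hb) ?_ hb
    rintro _ ⟨f, c, hf, rfl⟩
    exact Submodule.le_topologicalClosure _
      (Submodule.subset_span ⟨f, a * c, hf, (act_mul_right f a c).symm⟩)
  mul_mem_right' {b} a hb := by
    set J := (Submodule.span ℂ (vanishing A x)).topologicalClosure with hJ
    have hc : IsClosed (J : Set A) := Submodule.isClosed_topologicalClosure _
    refine closure_span_induction (S := vanishing A x) (P := fun b => b * a ∈ J)
      (hc.preimage (continuous_mul_const a)) (by simp)
      (fun b c hb hc => by rw [add_mul]; exact J.add_mem hb hc)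
      (fun t b hb => by rw [smul_mul_assoc]; exact J.smul_mem t hb) ?_ hb
    rintro _ ⟨f, c, hf, rfl⟩
    exact Submodule.le_topologicalClosure _
      (Submodule.subset_span ⟨f, c * a, hf, (act_mul_left f c a).symm⟩)
  star_mem' {b} hb := by
    set J := (Submodule.span ℂ (vanishing A x)).topologicalClosure with hJ
    have hc : IsClosed (J : Set A) := Submodule.isClosed_topologicalClosure _
    refine closure_span_induction (S := vanishing A x) (P := fun b => star b ∈ J)
      (hc.preimage continuous_star) (by simp)
      (fun b c hb hc => by rw [star_add]; exact J.add_mem hb hc)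
      (fun t b hb => by rw [star_smul]; exact J.smul_mem _ hb) ?_ hb
    rintro _ ⟨f, c, hf, rfl⟩
    exact Submodule.le_topologicalClosure _
      (Submodule.subset_span ⟨star f, star c, by simp [hf], star_act f c⟩)

variable (A) in
/-- The fibre `A_x = A / C_x(X) A`. -/
abbrev Fibre (x : X) : Type _ := (fibreIdeal A x).Quotient

variable (A) in
/-- The quotient map `σ^x : A → A_x`. -/
def fibreMap (x : X) : A →ₗ[ℂ] Fibre A x := (fibreIdeal A x).proj

lemma isClosed_fibreIdeal (x : X) : IsClosed ((fibreIdeal A x).toSubmodule : Set A) :=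
  Submodule.isClosed_topologicalClosure _

/-- The fibre carries the quotient norm. -/
instance (x : X) : NormedAddCommGroup (Fibre A x) where
  __ := (inferInstance : AddCommGroup (Fibre A x))
  __ := @Submodule.Quotient.normedAddCommGroup A _ ℂ _ _ (fibreIdeal A x).toSubmodule
    (isClosed_fibreIdeal x)

lemma norm_fibreMap_le (x : X) (a : A) : ‖fibreMap A x a‖ ≤ ‖a‖ :=
  Submodule.Quotient.norm_mk_le (fibreIdeal A x).toSubmodule a

lemma exists_norm_lt (x : X) (b : Fibre A x) {ε : ℝ} (hε : 0 < ε) :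
    ∃ a : A, fibreMap A x a = b ∧ ‖a‖ < ‖b‖ + ε :=
  Submodule.Quotient.norm_mk_lt (S := (fibreIdeal A x).toSubmodule) b hε

lemma exists_small (x : X) {a : A} (ha : a ∈ (fibreIdeal A x).toSubmodule) :
    ∀ ε : ℝ, 0 < ε → ∃ f : C(X, ℂ), ‖f‖ ≤ 1 ∧ f x = 1 ∧ ‖act f a‖ < ε := by
  have key : ∀ (f : C(X, ℂ)) (b : A), ‖f‖ ≤ 1 → ‖act f b‖ ≤ ‖b‖ := fun f b hf =>
    (norm_act_le f b).trans (mul_le_of_le_one_left (norm_nonneg _) hf)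
  refine closure_span_induction (S := vanishing A x)
    (P := fun a => ∀ ε : ℝ, 0 < ε → ∃ f : C(X, ℂ), ‖f‖ ≤ 1 ∧ f x = 1 ∧ ‖act f a‖ < ε)
    ?_ ?_ ?_ ?_ ?_ ha
  · refine isClosed_of_closure_subset fun a ha ε hε => ?_
    obtain ⟨b, hb, hab⟩ := Metric.mem_closure_iff.1 ha (ε / 2) (half_pos hε)
    obtain ⟨f, hf, hfx, hfb⟩ := hb (ε / 2) (half_pos hε)
    refine ⟨f, hf, hfx, ?_⟩
    have e : act f a = act f (a - b) + act f b := by rw [← map_add, sub_add_cancel]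
    rw [dist_eq_norm] at hab
    rw [e]
    linarith [norm_add_le (act f (a - b)) (act f b), key f (a - b) hf]
  · intro ε hε
    refine ⟨1, ?_, rfl, by simpa using hε⟩
    exact (ContinuousMap.norm_le _ zero_le_one).2 fun y => by simp
  · intro a b ha hb ε hε
    obtain ⟨f, hf, hfx, hfa⟩ := ha (ε / 2) (half_pos hε)
    obtain ⟨g, hg, hgx, hgb⟩ := hb (ε / 2) (half_pos hε)
    refine ⟨f * g, (norm_mul_le f g).trans (mul_le_one₀ hf (norm_nonneg _) hg),
      by simp [hfx, hgx], ?_⟩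
    have e : act (f * g) (a + b) = act g (act f a) + act f (act g b) := by
      rw [map_add, act_act, act_act, mul_comm g f]
    rw [e]
    linarith [norm_add_le (act g (act f a)) (act f (act g b)), key g (act f a) hg,
      key f (act g b) hf]
  · intro c a ha ε hε
    have hc : 0 < ‖c‖ + 1 := by positivity
    obtain ⟨f, hf, hfx, hfa⟩ := ha (ε / (‖c‖ + 1)) (by positivity)
    refine ⟨f, hf, hfx, ?_⟩
    rw [map_smul, norm_smul]
    rw [lt_div_iff₀ hc] at hfa
    nlinarith [norm_nonneg (act f a)]
  · rintro _ ⟨g, a, hg, rfl⟩ ε hε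
    have hδ : 0 < ε / (‖a‖ + 1) := by positivity
    set δ := ε / (‖a‖ + 1) with hδ'
    have hm : ∀ y, 0 < max δ ‖g y‖ := fun y => lt_max_of_lt_left hδ
    let f : C(X, ℂ) := ⟨fun y => ((δ / max δ ‖g y‖ : ℝ) : ℂ), by
      refine Complex.continuous_ofReal.comp (continuous_const.div (by fun_prop) ?_)
      exact fun y => (hm y).ne'⟩
    have hfy : ∀ y, ‖f y‖ = δ / max δ ‖g y‖ := fun y => by
      change ‖((δ / max δ ‖g y‖ : ℝ) : ℂ)‖ = _
      rw [Complex.norm_real, Real.norm_of_nonneg (div_nonneg hδ.le (hm y).le)]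
    refine ⟨f, ?_, ?_, ?_⟩
    · refine (ContinuousMap.norm_le _ zero_le_one).2 fun y => ?_
      rw [hfy]
      exact div_le_one_of_le₀ (le_max_left _ _) (hm y).le
    · change ((δ / max δ ‖g x‖ : ℝ) : ℂ) = 1
      rw [hg, norm_zero, max_eq_left hδ.le, div_self hδ.ne', Complex.ofReal_one]
    · have hfg : ‖f * g‖ ≤ δ := by
        refine (ContinuousMap.norm_le _ hδ.le).2 fun y => ?_
        rw [ContinuousMap.mul_apply, norm_mul, hfy, div_mul_eq_mul_div, div_le_iff₀ (hm y)]
        exact mul_le_mul_of_nonneg_left (le_max_right _ _) hδ.le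
      rw [act_act]
      have h1 : ‖act (f * g) a‖ ≤ δ * ‖a‖ :=
        (norm_act_le _ _).trans (mul_le_mul_of_nonneg_right hfg (norm_nonneg _))
      have h2 : δ * (‖a‖ + 1) = ε := div_mul_cancel₀ _ (by positivity)
      linarith

lemma fibreMap_act (x : X) (f : C(X, ℂ)) (hf : f x = 1) (a : A) :
    fibreMap A x (act f a) = fibreMap A x a := by
  refine ((fibreIdeal A x).proj_eq_proj).2 ?_
  rw [← neg_sub, neg_mem_iff]
  refine Submodule.le_topologicalClosure _ (Submodule.subset_span ⟨1 - f, a, by simp [hf], ?_⟩)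
  rw [act_sub_left, act_one]

lemma fibreMap_mul (x : X) (a b : A) :
    fibreMap A x (a * b) = fibreMap A x a * fibreMap A x b := rfl

lemma fibreMap_star (x : X) (a : A) : fibreMap A x (star a) = star (fibreMap A x a) := rfl

lemma fibre_norm_mul_le (x : X) (b c : Fibre A x) : ‖b * c‖ ≤ ‖b‖ * ‖c‖ := by
  refine le_of_forall_gt_imp_ge_of_dense fun t ht => ?_
  have hlim : Filter.Tendsto (fun ε : ℝ => (‖b‖ + ε) * (‖c‖ + ε)) (nhdsWithin 0 (Set.Ioi 0))
      (nhds (‖b‖ * ‖c‖)) := by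
    have h : Continuous fun ε : ℝ => (‖b‖ + ε) * (‖c‖ + ε) := by fun_prop
    have h' := h.tendsto 0
    simp only [add_zero] at h'
    exact h'.mono_left nhdsWithin_le_nhds
  obtain ⟨ε, hε, hε0⟩ :=
    ((hlim.eventually (gt_mem_nhds ht)).and self_mem_nhdsWithin).exists
  obtain ⟨a, rfl, ha⟩ := exists_norm_lt x b (Set.mem_Ioi.1 hε0)
  obtain ⟨a', rfl, ha'⟩ := exists_norm_lt x c (Set.mem_Ioi.1 hε0)
  rw [← fibreMap_mul]
  refine (norm_fibreMap_le x _).trans ((norm_mul_le _ _).trans (le_trans ?_ hε.le))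
  exact mul_le_mul ha.le ha'.le (norm_nonneg _) ((norm_nonneg _).trans ha.le)

lemma fibre_norm_mul_self_le (x : X) (b : Fibre A x) : ‖b‖ * ‖b‖ ≤ ‖star b * b‖ := by
  refine le_of_forall_pos_le_add fun ε hε => ?_
  obtain ⟨a, rfl⟩ := (fibreIdeal A x).proj_surjective b
  obtain ⟨c, hc, hcn⟩ := exists_norm_lt x (fibreMap A x (star a * a)) (half_pos hε)
  have hmem : star a * a - c ∈ (fibreIdeal A x).toSubmodule :=
    ((fibreIdeal A x).proj_eq_proj).1 hc.symm
  obtain ⟨f, hf, hfx, hfs⟩ := exists_small x hmem (ε / 2) (half_pos hε)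
  have key : ∀ (g : C(X, ℂ)) (b : A), ‖g‖ ≤ 1 → ‖act g b‖ ≤ ‖b‖ := fun g b hg =>
    (norm_act_le g b).trans (mul_le_of_le_one_left (norm_nonneg _) hg)
  have h1 : ‖fibreMap A x a‖ ≤ ‖act f a‖ := by
    rw [← fibreMap_act x f hfx a]; exact norm_fibreMap_le x _
  have h2 : ‖act f a‖ * ‖act f a‖ ≤ ‖act f (star a * a)‖ := by
    rw [← CStarRing.norm_star_mul_self, star_act, ← act_mul_left, ← act_mul_right]
    exact key (star f) _ (by rwa [norm_star])
  have h3 : act f (star a * a) = act f (star a * a - c) + act f c := by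
    rw [← map_add, sub_add_cancel]
  have h4 := norm_add_le (act f (star a * a - c)) (act f c)
  rw [← h3] at h4
  have h5 := mul_self_le_mul_self (norm_nonneg _) h1
  have h6 := key f c hf
  change ‖fibreMap A x a‖ * ‖fibreMap A x a‖ ≤ ‖fibreMap A x (star a * a)‖ + ε
  linarith

/-- The fibre is a C*-algebra for the quotient norm. -/
instance (x : X) : NonUnitalCStarAlgebra (Fibre A x) where
  dist_eq := NormedAddCommGroup.dist_eq
  norm_mul_le := fibre_norm_mul_le x
  toCompleteSpace :=
    inferInstanceAs (CompleteSpace (A ⧸ (fibreIdeal A x).toSubmodule))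
  norm_mul_self_le := fibre_norm_mul_self_le x
  norm_smul_le :=
    (inferInstance : NormedSpace ℂ (A ⧸ (fibreIdeal A x).toSubmodule)).norm_smul_le
  smul_zero := smul_zero
  smul_add := smul_add
  add_smul := add_smul
  zero_smul := zero_smul ℂ

/-! ### The ideal `J(A, B)` and the semi-norm `‖ ‖_m` -/

variable {B : Type*} [NonUnitalCStarAlgebra B] [CXAlgebra X B]

variable (A B) in
/-- The map `α ↦ α_x`, `A ⊗ B → A_x ⊗ B_x`, that is `σ^x ⊗ σ^x`. -/
def fibreTensorMap (x : X) : A ⊗[ℂ] B →ₗ[ℂ] Fibre A x ⊗[ℂ] Fibre B x :=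
  TensorProduct.map (fibreMap A x) (fibreMap B x)

lemma fibreTensorMap_mul (x : X) (α β : A ⊗[ℂ] B) :
    fibreTensorMap A B x (α * β) = fibreTensorMap A B x α * fibreTensorMap A B x β := by
  induction α with
  | zero => simp
  | add α₁ α₂ h₁ h₂ => simp only [add_mul, map_add, h₁, h₂]
  | tmul a b =>
    induction β with
    | zero => simp
    | add β₁ β₂ h₁ h₂ => simp only [mul_add, map_add, h₁, h₂]
    | tmul c d => simp [fibreTensorMap, fibreMap_mul]

lemma fibreTensorMap_star (x : X) (α : A ⊗[ℂ] B) :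
    fibreTensorMap A B x (star α) = star (fibreTensorMap A B x α) := by
  induction α with
  | zero => simp
  | add α₁ α₂ h₁ h₂ => simp only [star_add, map_add, h₁, h₂]
  | tmul a b => simp [fibreTensorMap, fibreMap_star]

variable (X A B) in
/-- The involutive ideal `J(A, B)` of the `α` with `α_x = 0` in `A_x ⊗ B_x` for all `x`. -/
def tensorIdeal : StarIdeal (A ⊗[ℂ] B) where
  carrier := {α | ∀ x : X, fibreTensorMap A B x α = 0}
  add_mem' hα hβ x := by rw [map_add, hα x, hβ x, add_zero]
  zero_mem' x := map_zero _
  smul_mem' c α hα x := by rw [map_smul, hα x, smul_zero]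
  mul_mem_left' α β hβ x := by rw [fibreTensorMap_mul, hβ x, mul_zero]
  mul_mem_right' β hα x := by rw [fibreTensorMap_mul, hα x, zero_mul]
  star_mem' hα x := by rw [fibreTensorMap_star, hα x, star_zero]

variable (X) in
/-- The semi-norm `‖α‖_m = sup_x ‖(σ₁^x ⊗_min σ₂^x)(α)‖`. -/
def mNorm (α : A ⊗[ℂ] B) : ℝ := ⨆ x : X, minTensorNorm (fibreTensorMap A B x α)

/-- The supremum defining `‖α‖_m` is a supremum of a bounded set. -/
lemma bddAbove_mNorm (α : A ⊗[ℂ] B) :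
    BddAbove (Set.range fun x : X => minTensorNorm (fibreTensorMap A B x α)) := by
  obtain ⟨n, a, b, rfl⟩ := exists_eq_sum_tmul α
  refine ⟨∑ i, ‖a i‖ * ‖b i‖, ?_⟩
  rintro _ ⟨x, rfl⟩
  refine Real.iSup_le (fun π => ?_) (by positivity)
  have e : fibreTensorMap A B x (∑ i, a i ⊗ₜ[ℂ] b i) =
      ∑ i, fibreMap A x (a i) ⊗ₜ[ℂ] fibreMap B x (b i) := by
    simp [fibreTensorMap]
  rw [e]
  refine (π.1.norm_tensor_le π.2 _ _).trans (Finset.sum_le_sum fun i _ => ?_)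
  exact mul_le_mul (norm_fibreMap_le x _) (norm_fibreMap_le x _) (norm_nonneg _) (norm_nonneg _)

end CXAlgebra

end

noncomputable section

open scoped InnerProductSpace ComplexOrder

/-! ### Suprema of C*-seminorms -/

section CStarSeminorm

variable {D : Type*} [NonUnitalRing D] [StarRing D] [Module ℂ D]

/-! That `‖·‖_m` is a C*-seminorm is formal: it is a supremum of pullbacks of C*-seminorms. Its
kernel is exactly `J(A, B)` because the minimal norm on a fibre is a norm: representations separate
points (Hahn–Banach and GNS), and slice maps carry this over to the tensor product
(`eq_zero_of_minTensorNorm_eq_zero`).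

For minimality, pull a C*-norm on the quotient back to a C*-seminorm `q` on `A ⊗ B`. Then `q (a ⊗ b)
≠ 0` whenever `a` and `b` are both nonzero at `x`, since their images in the fibres have a nonzero
tensor product. This is the only trace of the norm hypothesis, and it suffices for
`minTensorNorm_fibre_le`, the domination of the minimal norm at `x`.

That domination rests on excision. Given vector functionals `φ`, `ψ` of the two fibres and `α = ∑ aᵢ
⊗ bᵢ`, one looks for contractions `e₁`, `e₂` with `e₁ aᵢ e₁ ≈ lᵢ e₁²` and `e₂ bᵢ e₂ ≈ mᵢ e₂²`, each
acting as a unit on some element not vanishing at `x`. Then `q (e₁² ⊗ e₂²) ≥ 1`, and since `q` is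
subcross (`IsCStarSeminorm.tmul_le`), compressing `α` by `e₁ ⊗ e₂` gives `|∑ lᵢ mᵢ| ≤ q α` up to a
small error. Vector functionals need not be pure, so `lᵢ` cannot be required to approximate `φ
(aᵢ)`; it is enough that the real part of one prescribed linear combination does not decrease
(`exists_fibre_excision`). Using this once on each side gives `Re (φ ⊗ ψ)(α) ≤ q α`.

Applied to `α* α`, this bounds `(π₁ ⊗ π₂)(α)` on elementary tensors of unit vectors. On a general
vector it gives a bound by a multiple of `q α`, and iterating Cauchy–Schwarz along `α ↦ α* α` turns
the multiple into `‖ζ‖`. -/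

lemma IsCStarSeminorm.iSup {ι : Sort*} {p : ι → Seminorm ℂ D} (hp : ∀ i, IsCStarSeminorm (p i))
    (hb : ∀ a, BddAbove (Set.range fun i => p i a)) : IsCStarSeminorm (⨆ i, p i) := by
  have hb' : BddAbove (Set.range p) := Seminorm.bddAbove_range_iff.2 hb
  have hle : ∀ i a, p i a ≤ (⨆ i, p i) a := fun i a => by
    rw [Seminorm.iSup_apply hb']; exact le_ciSup (hb a) i
  -- Asking for `0 ≤ r` covers an empty index type, where the supremum is `0`.
  have hsup : ∀ a r, 0 ≤ r → (∀ i, p i a ≤ r) → (⨆ i, p i) a ≤ r := fun a r hr h => by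
    rw [Seminorm.iSup_apply hb']; exact Real.iSup_le h hr
  have hmul : ∀ a b, (⨆ i, p i) (a * b) ≤ (⨆ i, p i) a * (⨆ i, p i) b := fun a b =>
    hsup _ _ (mul_nonneg (apply_nonneg _ _) (apply_nonneg _ _)) fun i =>
      ((hp i).mul_le a b).trans
        (mul_le_mul (hle i a) (hle i b) (apply_nonneg _ _) (apply_nonneg _ _))
  refine ⟨hmul, fun a => le_antisymm ?_ ?_⟩
  · refine hsup _ _ (sq_nonneg _) fun i => ?_
    rw [(hp i).star_mul_self]
    exact pow_le_pow_left₀ (apply_nonneg _ _) (hle i a) 2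
  · refine (Real.le_sqrt (apply_nonneg _ _) (apply_nonneg _ _)).1 ?_
    refine hsup _ _ (Real.sqrt_nonneg _) fun i => ?_
    refine Real.le_sqrt_of_sq_le ?_
    rw [← (hp i).star_mul_self]
    exact hle i _

namespace IsCStarSeminorm

variable {p : Seminorm ℂ D}

lemma map_star_le (hp : IsCStarSeminorm p) (a : D) : p a ≤ p (star a) := by
  rcases (apply_nonneg p a).eq_or_lt with h | h
  · rw [← h]; exact apply_nonneg _ _
  · have h' := hp.mul_le (star a) a
    rw [hp.star_mul_self, sq] at h'
    exact le_of_mul_le_mul_right h' h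

lemma map_star (hp : IsCStarSeminorm p) (a : D) : p (star a) = p a := by
  refine le_antisymm ?_ (hp.map_star_le a)
  simpa using hp.map_star_le (star a)

lemma comp {E : Type*} [NonUnitalRing E] [StarRing E] [Module ℂ E] (hp : IsCStarSeminorm p)
    (f : E →ₗ[ℂ] D) (hmul : ∀ a b, f (a * b) = f a * f b) (hstar : ∀ a, f (star a) = star (f a)) :
    IsCStarSeminorm (p.comp f) where
  mul_le a b := by simpa only [Seminorm.comp_apply, hmul] using hp.mul_le (f a) (f b)
  star_mul_self a := by
    simpa only [Seminorm.comp_apply, hmul, hstar] using hp.star_mul_self (f a)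

end IsCStarSeminorm

end CStarSeminorm

/-! ### Tensor products of representations -/

section Spatial

variable {A B : Type*} [NonUnitalCStarAlgebra A] [NonUnitalCStarAlgebra B]

namespace HilbertRep

variable (π₁ : HilbertRep A) (π₂ : HilbertRep B)

lemma tensor_tmul_tmul (a : A) (b : B) (ξ : π₁.H) (η : π₂.H) :
    π₁.tensor π₂ (a ⊗ₜ b) (ξ ⊗ₜ η) = π₁.rep a ξ ⊗ₜ π₂.rep b η := rfl

lemma tensor_tmul (a : A) (b : B) :
    π₁.tensor π₂ (a ⊗ₜ b) = TensorProduct.mapL (π₁.rep a) (π₂.rep b) := rfl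

lemma tensor_mul (α β : A ⊗[ℂ] B) :
    π₁.tensor π₂ (α * β) = π₁.tensor π₂ α * π₁.tensor π₂ β := by
  induction α with
  | zero => simp
  | add α₁ α₂ h₁ h₂ => simp only [add_mul, map_add, h₁, h₂]
  | tmul a b =>
    induction β with
    | zero => simp
    | add β₁ β₂ h₁ h₂ => simp only [mul_add, map_add, h₁, h₂]
    | tmul c d =>
      simp only [Algebra.TensorProduct.tmul_mul_tmul, tensor_tmul, map_mul, TensorProduct.mapL_mul]

lemma inner_rep (a : A) (ξ ξ' : π₁.H) : ⟪π₁.rep a ξ, ξ'⟫_ℂ = ⟪ξ, π₁.rep (star a) ξ'⟫_ℂ := by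
  rw [map_star, ContinuousLinearMap.star_eq_adjoint, ContinuousLinearMap.adjoint_inner_right]

lemma inner_tensor (α : A ⊗[ℂ] B) (ζ ζ' : π₁.H ⊗[ℂ] π₂.H) :
    ⟪π₁.tensor π₂ α ζ, ζ'⟫_ℂ = ⟪ζ, π₁.tensor π₂ (star α) ζ'⟫_ℂ := by
  induction α with
  | zero => simp
  | add α₁ α₂ h₁ h₂ =>
    simp only [map_add, star_add, add_apply, inner_add_left, inner_add_right,
      h₁, h₂]
  | tmul a b =>
    induction ζ with
    | zero => simp
    | add ζ₁ ζ₂ h₁ h₂ => simp only [map_add, inner_add_left, h₁, h₂]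
    | tmul ξ η =>
      induction ζ' with
      | zero => simp
      | add ζ₁ ζ₂ h₁ h₂ => simp only [map_add, inner_add_right, h₁, h₂]
      | tmul ξ' η' =>
        rw [TensorProduct.star_tmul, tensor_tmul_tmul, tensor_tmul_tmul, TensorProduct.inner_tmul,
          TensorProduct.inner_tmul, inner_rep, inner_rep]

lemma norm_tensor_apply_sq (α : A ⊗[ℂ] B) (ζ : π₁.H ⊗[ℂ] π₂.H) :
    ‖π₁.tensor π₂ α ζ‖ ^ 2 = (⟪ζ, π₁.tensor π₂ (star α * α) ζ⟫_ℂ).re := by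
  have h : π₁.tensor π₂ (star α * α) ζ = π₁.tensor π₂ (star α) (π₁.tensor π₂ α ζ) := by
    rw [tensor_mul]; rfl
  rw [h, ← inner_tensor]
  exact (inner_self_eq_norm_sq (𝕜 := ℂ) _).symm

lemma norm_tensor_apply_sq_le (α : A ⊗[ℂ] B) (ζ : π₁.H ⊗[ℂ] π₂.H) :
    ‖π₁.tensor π₂ α ζ‖ ^ 2 ≤ ‖ζ‖ * ‖π₁.tensor π₂ (star α * α) ζ‖ := by
  rw [norm_tensor_apply_sq]
  exact re_inner_le_norm (𝕜 := ℂ) ζ (π₁.tensor π₂ (star α * α) ζ)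

/-- The C*-seminorm `α ↦ ‖(π₁ ⊗ π₂)(α)‖`. -/
def tensorSeminorm : Seminorm ℂ (A ⊗[ℂ] B) :=
  (normSeminorm ℂ (π₁.H ⊗[ℂ] π₂.H →L[ℂ] π₁.H ⊗[ℂ] π₂.H)).comp (π₁.tensor π₂)

lemma tensorSeminorm_apply (α : A ⊗[ℂ] B) : π₁.tensorSeminorm π₂ α = ‖π₁.tensor π₂ α‖ := rfl

lemma norm_tensor_mul_le (α β : A ⊗[ℂ] B) :
    ‖π₁.tensor π₂ (α * β)‖ ≤ ‖π₁.tensor π₂ α‖ * ‖π₁.tensor π₂ β‖ := by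
  rw [tensor_mul]
  exact ContinuousLinearMap.opNorm_comp_le _ _

/-- The space `H₁ ⊗ H₂` is not complete, so the C*-identity of bounded operators on a Hilbert space
does not apply; the formal adjoint relation `inner_tensor` and Cauchy–Schwarz replace it. -/
lemma norm_tensor_sq_le (α : A ⊗[ℂ] B) :
    ‖π₁.tensor π₂ α‖ ^ 2 ≤ ‖π₁.tensor π₂ (star α * α)‖ := by
  refine (Real.le_sqrt (ContinuousLinearMap.opNorm_nonneg _)
    (ContinuousLinearMap.opNorm_nonneg _)).1 ?_
  refine ContinuousLinearMap.opNorm_le_bound _ (Real.sqrt_nonneg _) fun ζ => ?_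
  refine (pow_le_pow_iff_left₀ (norm_nonneg _) (by positivity) two_ne_zero).1 ?_
  rw [mul_pow, Real.sq_sqrt (ContinuousLinearMap.opNorm_nonneg _)]
  refine (π₁.norm_tensor_apply_sq_le π₂ α ζ).trans ?_
  have := (π₁.tensor π₂ (star α * α)).le_opNorm ζ
  nlinarith [norm_nonneg ζ]

lemma norm_tensor_le_star (α : A ⊗[ℂ] B) : ‖π₁.tensor π₂ α‖ ≤ ‖π₁.tensor π₂ (star α)‖ := by
  rcases (ContinuousLinearMap.opNorm_nonneg (π₁.tensor π₂ α)).eq_or_lt with h | h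
  · rw [← h]; exact ContinuousLinearMap.opNorm_nonneg _
  · have h' := (π₁.norm_tensor_sq_le π₂ α).trans (π₁.norm_tensor_mul_le π₂ _ _)
    rw [sq] at h'
    exact le_of_mul_le_mul_right h' h

lemma isCStarSeminorm_tensorSeminorm : IsCStarSeminorm (π₁.tensorSeminorm π₂) where
  mul_le α β := π₁.norm_tensor_mul_le π₂ α β
  star_mul_self α := by
    simp only [tensorSeminorm_apply]
    refine le_antisymm ?_ (π₁.norm_tensor_sq_le π₂ α)
    refine (π₁.norm_tensor_mul_le π₂ _ _).trans ?_
    have := π₁.norm_tensor_le_star π₂ (star α)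
    rw [star_star] at this
    rw [sq]
    exact mul_le_mul_of_nonneg_right this (ContinuousLinearMap.opNorm_nonneg _)

end HilbertRep

variable (A B) in
/-- The minimal C*-norm as a seminorm. -/
def minTensorSeminorm : Seminorm ℂ (A ⊗[ℂ] B) :=
  ⨆ π : HilbertRep A × HilbertRep B, π.1.tensorSeminorm π.2

lemma minTensorSeminorm_apply (α : A ⊗[ℂ] B) : minTensorSeminorm A B α = minTensorNorm α :=
  Seminorm.iSup_apply (Seminorm.bddAbove_range_iff.2 bddAbove_minTensorNorm)

lemma isCStarSeminorm_minTensorSeminorm : IsCStarSeminorm (minTensorSeminorm A B) :=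
  .iSup (fun π => π.1.isCStarSeminorm_tensorSeminorm π.2) bddAbove_minTensorNorm

/-! ### Representations separate points -/

/-- Hahn–Banach separates `-h` from the closed cone of positive elements by a real functional `g`;
its values on real and imaginary parts define a complex linear functional. -/
lemma exists_positiveLinearMap_ne_zero [PartialOrder A] [StarOrderedRing A] {h : A} (h0 : 0 ≤ h)
    (hne : h ≠ 0) : ∃ f : A →ₚ[ℂ] ℂ, f h ≠ 0 := by
  let C : ProperCone ℝ A :=
    { carrier := {a | 0 ≤ a}
      add_mem' := fun ha hb => add_nonneg ha hb
      zero_mem' := le_refl (0 : A)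
      smul_mem' := fun c a (ha : 0 ≤ a) => (smul_nonneg c.2 ha : 0 ≤ (c : ℝ) • a)
      isClosed' := CStarAlgebra.isClosed_nonneg }
  have hmem : ∀ a : A, a ∈ C ↔ 0 ≤ a := fun a => Iff.rfl
  have hn : -h ∉ C := fun hc => hne (le_antisymm (neg_nonneg.1 ((hmem _).1 hc)) h0)
  obtain ⟨g, hg, hgh⟩ := C.hyperplane_separation_point hn
  let F : A →ₗ[ℂ] ℂ :=
    { toFun := fun a => (g (realPart a : A) : ℂ) + Complex.I * (g (imaginaryPart a : A) : ℂ)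
      map_add' := fun a b => by
        simp only [map_add, AddSubgroup.coe_add, Complex.ofReal_add]; ring
      map_smul' := fun c a => by
        simp only [realPart_smul, imaginaryPart_smul, AddSubgroup.coe_add, AddSubgroup.coe_sub,
          selfAdjoint.val_smul, map_add, map_sub, map_smul, smul_eq_mul, RingHom.id_apply,
          Complex.ofReal_add, Complex.ofReal_sub, Complex.ofReal_mul]
        conv_rhs => rw [← Complex.re_add_im c]
        linear_combination -((c.im : ℂ) * (g (imaginaryPart a : A) : ℂ)) * Complex.I_sq }
  have hF : ∀ a : A, IsSelfAdjoint a → F a = (g a : ℂ) := fun a ha => by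
    change (g (realPart a : A) : ℂ) + Complex.I * (g (imaginaryPart a : A) : ℂ) = _
    rw [ha.coe_realPart, ha.imaginaryPart]; simp
  refine ⟨PositiveLinearMap.mk₀ F fun a ha => ?_, ?_⟩
  · rw [hF a (.of_nonneg ha)]
    exact Complex.zero_le_real.2 (hg a ha)
  · change F h ≠ 0
    rw [hF h (.of_nonneg h0)]
    rw [map_neg, neg_lt_zero] at hgh
    exact_mod_cast hgh.ne'

/-- Without a unit there is no evident cyclic vector, so the GNS operator of `b` is tested on the
class of `star b`: the image has squared norm `f ((b b*)* (b b*))`, and `f` is chosen to make this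
nonzero. -/
lemma HilbertRep.exists_rep_ne_zero {b : A} (hb : b ≠ 0) : ∃ π : HilbertRep A, π.rep b ≠ 0 := by
  let _ := CStarAlgebra.spectralOrder A
  let _ := CStarAlgebra.spectralOrderedRing A
  have hs : star b ≠ 0 := star_ne_zero.2 hb
  have h1 : b * star b ≠ 0 := by
    simpa using mt (CStarRing.star_mul_self_eq_zero_iff (star b)).1 hs
  have h2 : star (b * star b) * (b * star b) ≠ 0 :=
    mt (CStarRing.star_mul_self_eq_zero_iff _).1 h1
  obtain ⟨f, hf⟩ := exists_positiveLinearMap_ne_zero (star_mul_self_nonneg (b * star b)) h2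
  refine ⟨⟨f.GNS, f.gnsNonUnitalStarAlgHom⟩, fun h => hf ?_⟩
  have h3 : f.gnsNonUnitalStarAlgHom b (f.toPreGNS (star b) : f.GNS) = 0 := by
    change f.gnsNonUnitalStarAlgHom b = 0 at h
    rw [h]; rfl
  rw [PositiveLinearMap.gnsNonUnitalStarAlgHom_apply_coe] at h3
  have h4 : ‖f.leftMulMapPreGNS b (f.toPreGNS (star b))‖ = 0 := by
    rw [← UniformSpace.Completion.norm_coe, h3, norm_zero]
  have h5 := f.preGNS_norm_sq (f.leftMulMapPreGNS b (f.toPreGNS (star b)))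
  rw [h4] at h5
  simpa using h5.symm

lemma HilbertRep.eq_zero_of_inner_rep_eq_zero {a : A}
    (h : ∀ (π : HilbertRep A) (ξ ξ' : π.H), ⟪ξ', π.rep a ξ⟫_ℂ = 0) : a = 0 := by
  by_contra ha
  obtain ⟨π, hπ⟩ := exists_rep_ne_zero ha
  refine hπ (ContinuousLinearMap.ext fun ξ => ?_)
  exact inner_self_eq_zero.1 (h π ξ (π.rep a ξ))

/-- Slicing the first factor by vector functionals sends `α` to `0` in `B`. Once `α` is expanded
along a basis of `B`, linear independence shows that every functional kills every coefficient in
`A`. -/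
lemma eq_zero_of_minTensorNorm_eq_zero {α : A ⊗[ℂ] B} (h : minTensorNorm α = 0) : α = 0 := by
  have hz : ∀ (π₁ : HilbertRep A) (π₂ : HilbertRep B), π₁.tensor π₂ α = 0 := fun π₁ π₂ => by
    have h1 : π₁.tensorSeminorm π₂ α ≤ 0 := by
      rw [← h]
      exact le_ciSup (bddAbove_minTensorNorm α) (π₁, π₂)
    exact (ContinuousLinearMap.opNorm_zero_iff _).1 (le_antisymm h1 (ContinuousLinearMap.opNorm_nonneg _))
  let slice : ∀ (π₁ : HilbertRep A) (_ _ : π₁.H), A ⊗[ℂ] B →ₗ[ℂ] B := fun π₁ ξ ξ' =>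
    TensorProduct.lift <| LinearMap.mk₂ ℂ (fun a b => ⟪ξ', π₁.rep a ξ⟫_ℂ • b)
      (fun a a' b => by rw [map_add, add_apply, inner_add_right, add_smul])
      (fun c a b => by rw [map_smul, smul_apply, inner_smul_right, mul_smul])
      (fun a b b' => smul_add _ _ _) (fun c a b => smul_comm _ _ _)
  have hslice : ∀ (π₁ : HilbertRep A) (ξ ξ' : π₁.H), slice π₁ ξ ξ' α = 0 := fun π₁ ξ ξ' => by
    refine HilbertRep.eq_zero_of_inner_rep_eq_zero fun π₂ η η' => ?_
    have key : ∀ β : A ⊗[ℂ] B, ⟪η', π₂.rep (slice π₁ ξ ξ' β) η⟫_ℂ =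
        ⟪ξ' ⊗ₜ[ℂ] η', π₁.tensor π₂ β (ξ ⊗ₜ η)⟫_ℂ := fun β => by
      induction β with
      | zero => simp
      | add β₁ β₂ h₁ h₂ => simp only [map_add, add_apply, inner_add_right, h₁, h₂]
      | tmul a b =>
        rw [HilbertRep.tensor_tmul_tmul, TensorProduct.inner_tmul]
        change ⟪η', π₂.rep (⟪ξ', π₁.rep a ξ⟫_ℂ • b) η⟫_ℂ = _
        rw [map_smul, smul_apply, inner_smul_right]
    rw [key, hz]
    exact inner_zero_right _
  classical
  let b := Module.Basis.ofVectorSpace ℂ B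
  obtain ⟨c, rfl⟩ := (TensorProduct.equivFinsuppOfBasisRight (R := ℂ) (M := A) b).symm.surjective α
  suffices c = 0 by rw [this, map_zero]
  ext i
  refine HilbertRep.eq_zero_of_inner_rep_eq_zero fun π₁ ξ ξ' => ?_
  have h1 := hslice π₁ ξ ξ'
  rw [TensorProduct.equivFinsuppOfBasisRight_symm_apply, Finsupp.sum, map_sum] at h1
  change ∑ j ∈ c.support, ⟪ξ', π₁.rep (c j) ξ⟫_ℂ • b j = 0 at h1
  by_cases hi : i ∈ c.support
  · exact linearIndependent_iff'.1 b.linearIndependent _ _ h1 i hi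
  · rw [Finsupp.notMem_support_iff.1 hi, map_zero]
    exact inner_zero_right _

end Spatial

/-! ### C*-seminorms on a tensor product are subcross -/

section Subcross

variable {A B : Type*} [NonUnitalCStarAlgebra A] [NonUnitalCStarAlgebra B]

variable (A) in
/-- Left multiplication by elements of the unitization. -/
def unitizationMul : Unitization ℂ A →ₗ[ℂ] A →ₗ[ℂ] A where
  toFun u := u.fst • LinearMap.id + LinearMap.mulLeft ℂ u.snd
  map_add' u v := by ext x; simp [add_smul, add_mul]; abel
  map_smul' c u := by ext x; simp [mul_smul, smul_mul_assoc]

lemma inr_unitizationMul (u : Unitization ℂ A) (x : A) :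
    (unitizationMul A u x : Unitization ℂ A) = u * (x : Unitization ℂ A) := by
  induction u with
  | inl_add_inr c a => simp [unitizationMul, add_mul, Unitization.inl_mul_inr]

lemma unitizationMul_inr (a : A) :
    unitizationMul A (a : Unitization ℂ A) = LinearMap.mulLeft ℂ a := by
  ext x; simp [unitizationMul]

lemma star_unitizationMul_mul {u : Unitization ℂ A} (hu : star u * u = 1) (a b : A) :
    star (unitizationMul A u a) * unitizationMul A u b = star a * b := by
  refine Unitization.inr_injective (R := ℂ) ?_
  rw [Unitization.inr_mul, Unitization.inr_star, inr_unitizationMul, inr_unitizationMul, star_mul,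
    Unitization.inr_mul, Unitization.inr_star, mul_assoc, ← mul_assoc (star u), hu, one_mul]

lemma star_rTensor_unitizationMul_mul {u : Unitization ℂ A} (hu : star u * u = 1)
    (α β : A ⊗[ℂ] B) :
    star ((unitizationMul A u).rTensor B α) * (unitizationMul A u).rTensor B β = star α * β := by
  induction α with
  | zero => simp
  | add α₁ α₂ h₁ h₂ => simp only [map_add, star_add, add_mul, h₁, h₂]
  | tmul a b =>
    induction β with
    | zero => simp
    | add β₁ β₂ h₁ h₂ => simp only [map_add, mul_add, h₁, h₂]
    | tmul c d =>
      simp only [LinearMap.rTensor_tmul, TensorProduct.star_tmul,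
        Algebra.TensorProduct.tmul_mul_tmul, star_unitizationMul_mul hu]

lemma star_rTensor_mulLeft_mul (a : A) (α β : A ⊗[ℂ] B) :
    star ((LinearMap.mulLeft ℂ a).rTensor B α) * (LinearMap.mulLeft ℂ a).rTensor B β =
      star α * (LinearMap.mulLeft ℂ (star a * a)).rTensor B β := by
  induction α with
  | zero => simp
  | add α₁ α₂ h₁ h₂ => simp only [map_add, star_add, add_mul, h₁, h₂]
  | tmul c d =>
    induction β with
    | zero => simp
    | add β₁ β₂ h₁ h₂ => simp only [map_add, mul_add, h₁, h₂]
    | tmul e f =>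
      simp only [LinearMap.rTensor_tmul, TensorProduct.star_tmul, LinearMap.mulLeft_apply,
        Algebra.TensorProduct.tmul_mul_tmul, star_mul, mul_assoc]

namespace IsCStarSeminorm

variable {q : Seminorm ℂ (A ⊗[ℂ] B)}

/-- The C*-identity expresses `q` through `star α * α`, which an isometry acting on the left leaves
unchanged. -/
lemma rTensor_unitary (hq : IsCStarSeminorm q) {u : Unitization ℂ A} (hu : star u * u = 1)
    (α : A ⊗[ℂ] B) : q ((unitizationMul A u).rTensor B α) = q α := by
  refine (pow_left_inj₀ (apply_nonneg _ _) (apply_nonneg _ _) two_ne_zero).1 ?_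
  rw [← hq.star_mul_self, ← hq.star_mul_self, star_rTensor_unitizationMul_mul hu]

/-- A self-adjoint contraction is the average of the unitaries `a ± i √(1 - a²)` of the unitization.
-/
lemma rTensor_mulLeft_le_of_norm_le_one (hq : IsCStarSeminorm q) {a : A} (ha : IsSelfAdjoint a)
    (ha1 : ‖a‖ ≤ 1) (α : A ⊗[ℂ] B) : q ((LinearMap.mulLeft ℂ a).rTensor B α) ≤ q α := by
  let _ := CStarAlgebra.spectralOrder (Unitization ℂ A)
  let _ := CStarAlgebra.spectralOrderedRing (Unitization ℂ A)
  have ha' : (a : Unitization ℂ A) ∈ selfAdjoint (Unitization ℂ A) := ha.inr ℂ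
  let s : selfAdjoint (Unitization ℂ A) := ⟨a, ha'⟩
  have hs : ‖s‖ ≤ 1 := by
    change ‖(a : Unitization ℂ A)‖ ≤ 1
    rwa [Unitization.norm_inr]
  let u := selfAdjoint.unitarySelfAddISMul s hs
  have h1 : star (u : Unitization ℂ A) * u = 1 := Unitary.coe_star_mul_self u
  have h2 : star (star (u : Unitization ℂ A)) * star (u : Unitization ℂ A) = 1 := by
    rw [star_star]; exact Unitary.coe_mul_star_self u
  have h3 : (a : Unitization ℂ A) = (2⁻¹ : ℂ) • ((u : Unitization ℂ A) + star u) := by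
    have h := congrArg Subtype.val (selfAdjoint.realPart_unitarySelfAddISMul s hs)
    rw [realPart_apply_coe] at h
    rw [show (2⁻¹ : ℂ) = ((2⁻¹ : ℝ) : ℂ) by norm_num, Complex.coe_smul]
    exact h.symm
  have h4 : (LinearMap.mulLeft ℂ a).rTensor B α = (2⁻¹ : ℂ) •
      ((unitizationMul A (u : Unitization ℂ A)).rTensor B α +
        (unitizationMul A (star u : Unitization ℂ A)).rTensor B α) := by
    rw [← unitizationMul_inr, h3, map_smul, map_add, LinearMap.rTensor_smul, LinearMap.rTensor_add]
    rfl
  rw [h4, map_smul_eq_mul]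
  have h5 := map_add_le_add q ((unitizationMul A (u : Unitization ℂ A)).rTensor B α)
    ((unitizationMul A (star u : Unitization ℂ A)).rTensor B α)
  rw [hq.rTensor_unitary h1, hq.rTensor_unitary h2] at h5
  norm_num
  linarith

lemma rTensor_mulLeft_le_of_isSelfAdjoint (hq : IsCStarSeminorm q) {a : A} (ha : IsSelfAdjoint a)
    (α : A ⊗[ℂ] B) : q ((LinearMap.mulLeft ℂ a).rTensor B α) ≤ ‖a‖ * q α := by
  rcases eq_or_ne a 0 with rfl | h0
  · simp
  have h1 : IsSelfAdjoint ((‖a‖⁻¹ : ℝ) • a) := (IsSelfAdjoint.all (‖a‖⁻¹)).smul ha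
  have hpos : 0 < ‖a‖ := norm_pos_iff.2 h0
  have h2 : ‖(‖a‖⁻¹ : ℝ) • a‖ ≤ 1 := by
    rw [norm_smul, norm_inv, norm_norm, inv_mul_cancel₀ hpos.ne']
  have h3 := hq.rTensor_mulLeft_le_of_norm_le_one h1 h2 α
  have h4 : (LinearMap.mulLeft ℂ ((‖a‖⁻¹ : ℝ) • a)).rTensor B α =
      ((‖a‖⁻¹ : ℝ) : ℂ) • (LinearMap.mulLeft ℂ a).rTensor B α := by
    rw [← LinearMap.smul_apply, ← LinearMap.rTensor_smul]
    congr 2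
    ext x
    simp [smul_mul_assoc, ← Complex.coe_smul]
  rw [h4, map_smul_eq_mul, Complex.norm_real, norm_inv, norm_norm, inv_mul_le_iff₀ hpos] at h3
  exact h3

lemma rTensor_mulLeft_le (hq : IsCStarSeminorm q) (a : A) (α : A ⊗[ℂ] B) :
    q ((LinearMap.mulLeft ℂ a).rTensor B α) ≤ ‖a‖ * q α := by
  refine (pow_le_pow_iff_left₀ (apply_nonneg _ _)
    (mul_nonneg (norm_nonneg _) (apply_nonneg _ _)) two_ne_zero).1 ?_
  rw [← hq.star_mul_self, star_rTensor_mulLeft_mul]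
  refine (hq.mul_le _ _).trans ?_
  have h := hq.rTensor_mulLeft_le_of_isSelfAdjoint (IsSelfAdjoint.star_mul_self a) α
  rw [CStarRing.norm_star_mul_self] at h
  rw [hq.map_star]
  nlinarith [apply_nonneg q α]

lemma comm (hq : IsCStarSeminorm q) :
    IsCStarSeminorm (q.comp (TensorProduct.comm ℂ B A).toLinearMap) := by
  refine hq.comp _ (fun α β => ?_) fun α => ?_
  · induction α with
    | zero => simp
    | add α₁ α₂ h₁ h₂ => simp only [add_mul, map_add, h₁, h₂]
    | tmul a b =>
      induction β with
      | zero => simp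
      | add β₁ β₂ h₁ h₂ => simp only [mul_add, map_add, h₁, h₂]
      | tmul c d => simp
  · induction α with
    | zero => simp
    | add α₁ α₂ h₁ h₂ => simp only [star_add, map_add, h₁, h₂]
    | tmul a b => simp

/-- A C*-seminorm on a tensor product of C*-algebras is subcross. -/
lemma tmul_le (hq : IsCStarSeminorm q) (a : A) (b : B) : q (a ⊗ₜ b) ≤ ‖a‖ * ‖b‖ := by
  rcases (apply_nonneg q (a ⊗ₜ[ℂ] b)).eq_or_lt with h | h
  · rw [← h]; positivity
  -- After multiplication by `q (a ⊗ b)`, the left side is `q (a*a ⊗ b*b)`; removing `a*` and `b*`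
  -- one factor at a time returns `‖a‖ ‖b‖ q (a ⊗ b)`.
  refine le_of_mul_le_mul_right ?_ h
  rw [← sq, ← hq.star_mul_self, TensorProduct.star_tmul, Algebra.TensorProduct.tmul_mul_tmul]
  have h1 := hq.rTensor_mulLeft_le (star a) (a ⊗ₜ[ℂ] (star b * b))
  have h2 := hq.comm.rTensor_mulLeft_le (star b) (b ⊗ₜ[ℂ] a)
  simp only [LinearMap.rTensor_tmul, LinearMap.mulLeft_apply, Seminorm.comp_apply,
    LinearEquiv.coe_coe, TensorProduct.comm_tmul, norm_star] at h1 h2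
  refine h1.trans ?_
  rw [mul_assoc]
  exact mul_le_mul_of_nonneg_left h2 (norm_nonneg _)

end IsCStarSeminorm

end Subcross

/-! ### Piecewise linear cut-off functions -/

/-- The piecewise linear function that is `0` before `c` and `1` after `c + r`. -/
def ramp (c r t : ℝ) : ℝ := max 0 (min 1 ((t - c) / r))

lemma continuous_ramp (c r : ℝ) : Continuous (ramp c r) := by unfold ramp; fun_prop

lemma ramp_nonneg (c r t : ℝ) : 0 ≤ ramp c r t := le_max_left _ _

lemma ramp_le_one (c r t : ℝ) : ramp c r t ≤ 1 := max_le zero_le_one (min_le_left _ _)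

lemma ramp_of_le {c r t : ℝ} (hr : 0 < r) (h : t ≤ c) : ramp c r t = 0 :=
  max_eq_left ((min_le_right _ _).trans (div_nonpos_of_nonpos_of_nonneg (by linarith) hr.le))

lemma ramp_of_ge {c r t : ℝ} (hr : 0 < r) (h : c + r ≤ t) : ramp c r t = 1 := by
  have : 1 ≤ (t - c) / r := by rw [le_div_iff₀ hr]; linarith
  rw [ramp, min_eq_left this, max_eq_right zero_le_one]

lemma abs_ramp_le_one (c r t : ℝ) : ‖ramp c r t‖ ≤ 1 := by
  rw [Real.norm_of_nonneg (ramp_nonneg _ _ _)]; exact ramp_le_one _ _ _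

/-- Source of all local units below: the wider cut-off is `1` on the support of the narrower one. -/
lemma ramp_quarter_mul_ramp_half (t : ℝ) :
    ramp (1 / 4) (1 / 4) t * ramp (1 / 2) (1 / 2) t = ramp (1 / 2) (1 / 2) t := by
  rcases le_total t (1 / 2) with h | h
  · rw [ramp_of_le (by norm_num) h, mul_zero]
  · rw [ramp_of_ge (c := 1 / 4) (by norm_num) (by linarith), one_mul]

/-! ### Excision in a unital C*-algebra -/

section Excision

variable {U : Type*} [CStarAlgebra U]

/-- The positive element `f(d)`, where `f` vanishes on `t ≤ 1/4` and is `1` on `t ≥ 1/2`. -/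
def bump (d : U) : U := cfc (ramp (1 / 4) (1 / 4)) d

lemma isSelfAdjoint_bump (d : U) : IsSelfAdjoint (bump d) := cfc_predicate _ _

lemma norm_bump_le (d : U) : ‖bump d‖ ≤ 1 := norm_cfc_le zero_le_one fun _ _ => abs_ramp_le_one _ _ _

/-- A cut-off vanishing on `t ≤ c` with `c > 0` is `t` times a continuous function, so `z` factors
out on the left of its functional calculus. The maximum in the denominator only avoids division by
zero. -/
lemma mul_cfc_ramp {e z : U} (h : e * z = z) (hz : IsSelfAdjoint z) {c : ℝ} (hc : 0 < c) {r : ℝ}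
    (hr : 0 < r) : e * cfc (ramp c r) z = cfc (ramp c r) z := by
  have h1 : (ramp c r) = fun t => t * (ramp c r t / max t c) := by
    ext t
    rcases le_total t c with ht | ht
    · rw [ramp_of_le hr ht]; simp
    · rw [max_eq_left ht, mul_div_cancel₀ _ (hc.trans_le ht).ne']
  have hcont : Continuous fun t => ramp c r t / max t c :=
    (continuous_ramp c r).div (by fun_prop) fun t => (lt_max_of_lt_right hc).ne'
  have h2 : cfc (ramp c r) z = z * cfc (fun t => ramp c r t / max t c) z := by
    conv_lhs => rw [h1]
    rw [cfc_mul (fun t => t) _ z continuousOn_id hcont.continuousOn, cfc_id' ℝ z]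
  rw [h2, ← mul_assoc, h]

lemma cfc_ramp_mul {e z : U} (h : e * z = z) (he : IsSelfAdjoint e) (hz : IsSelfAdjoint z) {c : ℝ}
    (hc : 0 < c) {r : ℝ} (hr : 0 < r) : cfc (ramp c r) z * e = cfc (ramp c r) z := by
  have h1 := congrArg star (mul_cfc_ramp h hz hc hr)
  have h2 : IsSelfAdjoint (cfc (ramp c r) z) := cfc_predicate _ _
  rwa [star_mul, h2.star_eq, he.star_eq] at h1

lemma mul_bump {e z : U} (h : e * z = z) (hz : IsSelfAdjoint z) : e * bump z = bump z :=
  mul_cfc_ramp h hz (by norm_num) (by norm_num)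

lemma bump_mul {e z : U} (h : e * z = z) (he : IsSelfAdjoint e) (hz : IsSelfAdjoint z) :
    bump z * e = bump z :=
  cfc_ramp_mul h he hz (by norm_num) (by norm_num)

lemma bump_mul_cfc_ramp_half (d : U) :
    bump d * cfc (ramp (1 / 2) (1 / 2)) d = cfc (ramp (1 / 2) (1 / 2)) d := by
  rw [bump, ← cfc_mul _ _ d (continuous_ramp _ _).continuousOn (continuous_ramp _ _).continuousOn]
  simp only [ramp_quarter_mul_ramp_half]

/-- On the spectral subspace of `y` near the top `M` of its spectrum, `y` is close to `M`. -/
lemma norm_bump_cfc_ramp_le {y : U} (hy : IsSelfAdjoint y) {M δ : ℝ} (hδ : 0 < δ)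
    (hM : ∀ t ∈ spectrum ℝ y, t ≤ M + 2 * δ) :
    ‖bump (cfc (ramp (M - 2 * δ) δ) y) * y * bump (cfc (ramp (M - 2 * δ) δ) y) -
      (M : ℂ) • (bump (cfc (ramp (M - 2 * δ) δ) y) * bump (cfc (ramp (M - 2 * δ) δ) y))‖ ≤
      2 * δ := by
  set E : ℝ → ℝ := fun t => ramp (1 / 4) (1 / 4) (ramp (M - 2 * δ) δ t) with hE
  have hEc : Continuous E := (continuous_ramp _ _).comp (continuous_ramp _ _)
  have he : bump (cfc (ramp (M - 2 * δ) δ) y) = cfc E y :=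
    (cfc_comp' (ramp (1 / 4) (1 / 4)) (ramp (M - 2 * δ) δ) y (continuous_ramp _ _).continuousOn
      (continuous_ramp _ _).continuousOn).symm
  have h1 : cfc E y * y * cfc E y - (M : ℂ) • (cfc E y * cfc E y) =
      cfc (fun t => E t * t * E t - M * (E t * E t)) y := by
    rw [cfc_sub _ _ y, cfc_mul _ _ y, cfc_mul _ _ y, cfc_id' ℝ y, cfc_const_mul _ _ y, cfc_mul _ _ y,
      Complex.coe_smul]
  rw [he, h1]
  refine norm_cfc_le (by positivity) fun t ht => ?_
  have hE0 : 0 ≤ E t := ramp_nonneg _ _ _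
  have hE1 : E t ≤ 1 := ramp_le_one _ _ _
  rcases le_total t (M - 2 * δ) with h | h
  · have : E t = 0 := by
      rw [hE]; simp only; rw [ramp_of_le hδ h, ramp_of_le (by norm_num) (by norm_num)]
    rw [this]; simp; positivity
  · have h2 : E t * t * E t - M * (E t * E t) = E t * E t * (t - M) := by ring
    rw [h2, norm_mul, Real.norm_of_nonneg (by positivity), Real.norm_eq_abs]
    have h3 : |t - M| ≤ 2 * δ := abs_le.2 ⟨by linarith, by linarith [hM t ht]⟩
    calc E t * E t * |t - M| ≤ 1 * (2 * δ) := by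
          refine mul_le_mul (mul_le_one₀ hE1 hE0 hE1) h3 (abs_nonneg _) zero_le_one
      _ = 2 * δ := one_mul _

/-- Excision passes to smaller elements: compression by `bump d'` factors through compression by the
contraction `bump d`, with the same scalar. -/
lemma norm_excision_le_of_bump_mul {d d' z : U} (hd' : IsSelfAdjoint d') (h : bump d * d' = d')
    {c : ℂ} {ε : ℝ} (hc : ‖bump d * z * bump d - c • (bump d * bump d)‖ ≤ ε) :
    ‖bump d' * z * bump d' - c • (bump d' * bump d')‖ ≤ ε := by
  have h1 : bump d * bump d' = bump d' := mul_bump h hd'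
  have h2 : bump d' * bump d = bump d' := bump_mul h (isSelfAdjoint_bump _) hd'
  have h3 : bump d' * z * bump d' - c • (bump d' * bump d') =
      bump d' * (bump d * z * bump d - c • (bump d * bump d)) * bump d' := by
    rw [mul_sub, sub_mul, mul_smul_comm, smul_mul_assoc]
    congr 1
    · calc bump d' * z * bump d' = (bump d' * bump d) * z * (bump d * bump d') := by rw [h1, h2]
        _ = _ := by simp only [mul_assoc]
    · congr 1
      calc bump d' * bump d' = (bump d' * bump d) * (bump d * bump d') := by rw [h1, h2]
        _ = _ := by simp only [mul_assoc]
  rw [h3]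
  refine (norm_mul_le _ _).trans ((mul_le_of_le_one_right (norm_nonneg _) (norm_bump_le _)).trans ?_)
  exact (norm_mul_le _ _).trans ((mul_le_of_le_one_left (norm_nonneg _) (norm_bump_le _)).trans hc)

lemma bump_mul_trans {d d₁ d₂ : U} (hd₁ : IsSelfAdjoint d₁) (h₁ : bump d * d₁ = d₁)
    (h₂ : bump d₁ * d₂ = d₂) : bump d * d₂ = d₂ := by
  rw [← h₂, ← mul_assoc, mul_bump h₁ hd₁]

variable [PartialOrder U]

/-- Positive elements of norm one. -/
def IsPeak (d : U) : Prop := 0 ≤ d ∧ ‖d‖ = 1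

lemma IsPeak.ne_zero {d : U} (hd : IsPeak d) : d ≠ 0 := norm_pos_iff.1 (hd.2.symm ▸ one_pos)

variable [StarOrderedRing U]

lemma isPeak_cfc_ramp {y : U} {c r t : ℝ} (hr : 0 < r) (ht : t ∈ spectrum ℝ y)
    (hct : c + r ≤ t) (hy : IsSelfAdjoint y) : IsPeak (cfc (ramp c r) y) := by
  refine ⟨cfc_nonneg fun _ _ => ramp_nonneg _ _ _,
    le_antisymm (norm_cfc_le zero_le_one fun _ _ => abs_ramp_le_one _ _ _) ?_⟩
  have h := norm_apply_le_norm_cfc (ramp c r) y ht (continuous_ramp _ _).continuousOn hy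
  rwa [ramp_of_ge hr hct, norm_one] at h

namespace IsPeak

variable {d : U}

lemma isSelfAdjoint (hd : IsPeak d) : IsSelfAdjoint d := .of_nonneg hd.1

lemma one_mem_spectrum (hd : IsPeak d) : (1 : ℝ) ∈ spectrum ℝ d := by
  have : Nontrivial U := nontrivial_of_ne _ _ hd.ne_zero
  rw [← hd.2]; exact CStarAlgebra.norm_mem_spectrum_of_nonneg hd.1

lemma cfc_ramp_half (hd : IsPeak d) : IsPeak (cfc (ramp (1 / 2) (1 / 2)) d) :=
  isPeak_cfc_ramp (by norm_num) hd.one_mem_spectrum (by norm_num) hd.isSelfAdjoint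

lemma one_le_norm_bump_mul_bump (hd : IsPeak d) : 1 ≤ ‖bump d * bump d‖ := by
  have h := isPeak_cfc_ramp (c := 1 / 4) (r := 1 / 4) (by norm_num) hd.one_mem_spectrum
    (by norm_num) hd.isSelfAdjoint
  change IsPeak (bump d) at h
  rw [h.isSelfAdjoint.norm_mul_self, h.2, one_pow]

end IsPeak

/-- For `0 ≤ k ≤ 1` one has `(1 - k)² ≤ 1 - k²`. -/
lemma norm_one_sub_mul_sq_le {k e : U} (hk0 : 0 ≤ k) (hk1 : k ≤ 1) (he : IsSelfAdjoint e) {r : ℝ}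
    (hr : 0 ≤ r) (h : e * (1 - k * k) * e ≤ algebraMap ℝ U r) : ‖(1 - k) * e‖ ^ 2 ≤ r := by
  have hksa : IsSelfAdjoint k := .of_nonneg hk0
  have h1 : (1 - k) * (1 - k) ≤ 1 - k * k := by
    have h2 : k * k ≤ k := by
      simpa [sq] using CStarAlgebra.pow_antitone hk0 hk1 (show 1 ≤ 2 by norm_num)
    rw [← sub_nonneg] at h2 ⊢
    have h3 : 1 - k * k - (1 - k) * (1 - k) = (k - k * k) + (k - k * k) := by noncomm_ring
    rw [h3]
    exact add_nonneg h2 h2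
  have h4 := (he.conjugate_le_conjugate h1).trans h
  have h5 : star ((1 - k) * e) * ((1 - k) * e) = e * ((1 - k) * (1 - k)) * e := by
    rw [star_mul, star_sub, star_one, hksa.star_eq, he.star_eq]; simp only [mul_assoc]
  rw [sq, ← CStarRing.norm_star_mul_self]
  rw [← h5] at h4
  exact (CStarAlgebra.norm_le_iff_le_algebraMap _ hr (star_mul_self_nonneg _)).2 h4

/-- The cut-off lives on `t ≥ m - 2δ`, where `1 - t / (m + δ) ≤ 3δ / (m + δ) ≤ 3δ`. -/
lemma bump_mul_one_sub_mul_bump_le {y : U} (hy : IsSelfAdjoint y) {m δ : ℝ} (hm1 : 1 ≤ m)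
    (hδ : 0 < δ) :
    bump (cfc (ramp (m - 2 * δ) δ) y) * (1 - (m + δ)⁻¹ • y) * bump (cfc (ramp (m - 2 * δ) δ) y) ≤
      algebraMap ℝ U (3 * δ) := by
  have hmd : 0 < m + δ := by linarith
  set E : ℝ → ℝ := fun t => ramp (1 / 4) (1 / 4) (ramp (m - 2 * δ) δ t) with hE'
  have hEc : Continuous E := (continuous_ramp _ _).comp (continuous_ramp _ _)
  have hE : bump (cfc (ramp (m - 2 * δ) δ) y) = cfc E y :=
    (cfc_comp' (ramp (1 / 4) (1 / 4)) (ramp (m - 2 * δ) δ) y (continuous_ramp _ _).continuousOn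
      (continuous_ramp _ _).continuousOn).symm
  rw [hE]
  have h2 : cfc E y * (1 - (m + δ)⁻¹ • y) * cfc E y =
      cfc (fun t => E t * (1 - (m + δ)⁻¹ * t) * E t) y := by
    rw [cfc_mul _ _ y, cfc_mul _ _ y, cfc_sub _ _ y, cfc_const_mul _ _ y, cfc_id' ℝ y,
      cfc_const_one ℝ y]
  rw [h2]
  refine cfc_le_algebraMap _ _ _ fun t ht => ?_
  have hE0 : 0 ≤ E t := ramp_nonneg _ _ _
  have hE1 : E t ≤ 1 := ramp_le_one _ _ _
  rcases le_total t (m - 2 * δ) with h | h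
  · have : E t = 0 := by
      simp only [hE']; rw [ramp_of_le hδ h, ramp_of_le (by norm_num) (by norm_num)]
    rw [this]; simp; positivity
  · have h3 : 1 - (m + δ)⁻¹ * t ≤ 3 * δ := by
      have h4 : (m + δ)⁻¹ * (m + δ) = 1 := inv_mul_cancel₀ hmd.ne'
      have h5 : (m + δ)⁻¹ ≤ 1 := inv_le_one_of_one_le₀ (by linarith)
      have h6 : 0 < (m + δ)⁻¹ := inv_pos.2 hmd
      nlinarith
    have h4 : E t * E t ≤ 1 := mul_le_one₀ hE1 hE0 hE1
    calc E t * (1 - (m + δ)⁻¹ * t) * E t = E t * E t * (1 - (m + δ)⁻¹ * t) := by ring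
      _ ≤ E t * E t * (3 * δ) := mul_le_mul_of_nonneg_left h3 (mul_nonneg hE0 hE0)
      _ ≤ 3 * δ := mul_le_of_le_one_left (by positivity) h4

/-- Minimise the norm of the compression of `x` over all peaks under `d`, with infimum `m`. Near a
minimiser, `y = k x k` has norm at least `m` and satisfies `y ≤ (m + δ) k²`. On the top spectral
subspace of `y`, where `y ≈ m`, this forces `k² ≈ 1`; hence `x` compresses there like `y`, that is,
like `m`. -/
lemma exists_excision_of_one_le {d x : U} (hd : IsPeak d) (hx : 1 ≤ x) {ε : ℝ} (hε : 0 < ε) :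
    ∃ d', IsPeak d' ∧ bump d * d' = d' ∧
      ∃ m : ℝ, ‖bump d' * x * bump d' - (m : ℂ) • (bump d' * bump d')‖ ≤ ε := by
  have : Nontrivial U := nontrivial_of_ne _ _ hd.ne_zero
  have hx0 : 0 ≤ x := zero_le_one.trans hx
  set S : Set ℝ := {r | ∃ d'', IsPeak d'' ∧ bump d * d'' = d'' ∧ r = ‖bump d'' * x * bump d''‖}
    with hS
  have hS1 : ∀ r ∈ S, 1 ≤ r := by
    rintro _ ⟨d'', h1, -, rfl⟩
    refine h1.one_le_norm_bump_mul_bump.trans ?_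
    have h2 := (isSelfAdjoint_bump d'').conjugate_le_conjugate hx
    rw [mul_one] at h2
    exact CStarAlgebra.norm_le_norm_of_nonneg_of_le (isSelfAdjoint_bump d'').mul_self_nonneg h2
  have hSne : S.Nonempty := ⟨_, _, hd.cfc_ramp_half, bump_mul_cfc_ramp_half d, rfl⟩
  set m := sInf S with hm
  have hm1 : 1 ≤ m := le_csInf hSne hS1
  -- The error will be `2δ` from `y ≈ m` plus twice `‖x‖ √(3δ)` from replacing `e` by `k e`. The
  -- bound `2δ < 1 ≤ m` keeps the cut-off at `m - 2δ` away from `0`.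
  obtain ⟨δ, hδ, hδm, hδε⟩ : ∃ δ : ℝ, 0 < δ ∧ 2 * δ < 1 ∧
      2 * δ + 2 * ‖x‖ * √(3 * δ) ≤ ε := by
    have hc : Filter.Tendsto (fun δ : ℝ => 2 * δ + 2 * ‖x‖ * √(3 * δ)) (nhdsWithin 0 (Set.Ioi 0))
        (nhds 0) := by
      have : Continuous fun δ : ℝ => 2 * δ + 2 * ‖x‖ * √(3 * δ) := by fun_prop
      have h' := this.tendsto 0
      simp only [mul_zero, Real.sqrt_zero, add_zero] at h'
      exact h'.mono_left nhdsWithin_le_nhds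
    have h1 := hc.eventually (ge_mem_nhds hε)
    have h2 : ∀ᶠ δ : ℝ in nhdsWithin 0 (Set.Ioi 0), δ < 1 / 2 :=
      nhdsWithin_le_nhds (gt_mem_nhds (by norm_num))
    obtain ⟨δ, h3, h4, h5⟩ := (h1.and (h2.and self_mem_nhdsWithin)).exists
    exact ⟨δ, h5, by linarith, h3⟩
  obtain ⟨_, ⟨d₁, hd₁, hdd₁, rfl⟩, hlt⟩ := exists_lt_of_csInf_lt hSne (lt_add_of_pos_right m hδ)
  -- Narrowing `d₁` to `d₂` makes `bump d₁` a unit for `k = bump d₂`: the competitor `d₁` bounds `y`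
  -- from above, while `d₂`, itself a competitor, bounds `‖y‖` from below by `m`.
  set d₂ := cfc (ramp (1 / 2) (1 / 2)) d₁ with hd₂'
  have hd₂ : IsPeak d₂ := hd₁.cfc_ramp_half
  have hdd₂ : bump d * d₂ = d₂ := mul_cfc_ramp hdd₁ hd₁.isSelfAdjoint (by norm_num) (by norm_num)
  have h12 : bump d₁ * d₂ = d₂ := bump_mul_cfc_ramp_half d₁
  set k := bump d₂ with hk
  have hksa : IsSelfAdjoint k := isSelfAdjoint_bump _
  have hk0 : 0 ≤ k := cfc_nonneg fun _ _ => ramp_nonneg _ _ _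
  have hk1 : k ≤ 1 := cfc_le_one _ _ fun _ _ => ramp_le_one _ _ _
  have hek : bump d₁ * k = k := mul_bump h12 hd₂.isSelfAdjoint
  have hke : k * bump d₁ = k := bump_mul h12 (isSelfAdjoint_bump _) hd₂.isSelfAdjoint
  set y := k * x * k with hy
  have hy0 : 0 ≤ y := hksa.conjugate_nonneg hx0
  have hysa : IsSelfAdjoint y := .of_nonneg hy0
  have hym : m ≤ ‖y‖ := csInf_le ⟨1, hS1⟩ ⟨d₂, hd₂, hdd₂, rfl⟩
  have hye : y = k * (bump d₁ * x * bump d₁) * k := by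
    rw [hy]
    calc k * x * k = (k * bump d₁) * x * (bump d₁ * k) := by rw [hek, hke]
      _ = _ := by simp only [mul_assoc]
  have hyk : y ≤ (m + δ) • (k * k) := by
    have h1 : bump d₁ * x * bump d₁ ≤ algebraMap ℝ U (m + δ) := by
      refine (IsSelfAdjoint.le_algebraMap_norm_self ?_).trans (algebraMap_mono U hlt.le)
      exact .of_nonneg ((isSelfAdjoint_bump _).conjugate_nonneg hx0)
    have h2 := hksa.conjugate_le_conjugate h1
    rwa [← hye, Algebra.algebraMap_eq_smul_one, mul_smul_comm, mul_one, smul_mul_assoc] at h2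
  have hyle : ‖y‖ ≤ m + δ := by
    rw [hye]
    refine (norm_mul_le _ _).trans ?_
    have h1 := norm_mul_le k (bump d₁ * x * bump d₁)
    have h2 : ‖k‖ ≤ 1 := norm_bump_le _
    have h3 := norm_nonneg k
    have h4 := norm_nonneg (bump d₁ * x * bump d₁)
    have h5 : ‖k‖ * ‖bump d₁ * x * bump d₁‖ ≤ ‖bump d₁ * x * bump d₁‖ :=
      mul_le_of_le_one_left h4 h2
    calc _ ≤ ‖k * (bump d₁ * x * bump d₁)‖ := mul_le_of_le_one_right (norm_nonneg _) h2
      _ ≤ m + δ := by linarith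
  have hspec : ∀ t ∈ spectrum ℝ y, t ≤ m + δ := fun t ht =>
    (le_abs_self t).trans ((spectrum.norm_le_norm_of_mem ht).trans hyle)
  set d' := cfc (ramp (m - 2 * δ) δ) y with hd'
  have hd'p : IsPeak d' := isPeak_cfc_ramp hδ (CStarAlgebra.norm_mem_spectrum_of_nonneg hy0)
    (by linarith) hysa
  have hyd : bump d * y = y := by
    rw [hy, ← mul_assoc, ← mul_assoc, mul_bump hdd₂ hd₂.isSelfAdjoint]
  refine ⟨d', hd'p, mul_cfc_ramp hyd hysa (by linarith) hδ, m, ?_⟩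
  set e := bump d' with he
  have hesa : IsSelfAdjoint e := isSelfAdjoint_bump _
  have he1 : ‖e‖ ≤ 1 := norm_bump_le _
  have hmain : ‖e * y * e - (m : ℂ) • (e * e)‖ ≤ 2 * δ :=
    norm_bump_cfc_ramp_le hysa hδ fun t ht => (hspec t ht).trans (by linarith)
  have hclose : ‖(1 - k) * e‖ ≤ √(3 * δ) := by
    refine Real.le_sqrt_of_sq_le (norm_one_sub_mul_sq_le hk0 hk1 hesa (by positivity) ?_)
    have hmd : 0 < m + δ := by linarith
    have h1 : (m + δ)⁻¹ • y ≤ k * k := by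
      have := smul_le_smul_of_nonneg_left hyk (inv_nonneg.2 hmd.le)
      rwa [smul_smul, inv_mul_cancel₀ hmd.ne', one_smul] at this
    refine (hesa.conjugate_le_conjugate (sub_le_sub_left h1 1)).trans ?_
    exact bump_mul_one_sub_mul_bump_le hysa hm1 hδ
  have hd1 : e * x * e - (m : ℂ) • (e * e) =
      (e * y * e - (m : ℂ) • (e * e)) + (e * x * ((1 - k) * e) + e * (1 - k) * x * (k * e)) := by
    rw [hy]; noncomm_ring
  have hnk : ‖e * (1 - k)‖ = ‖(1 - k) * e‖ := by
    rw [← norm_star, star_mul, star_sub, star_one, hesa.star_eq, hksa.star_eq]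
  have hke1 : ‖k * e‖ ≤ 1 := (norm_mul_le _ _).trans
    (mul_le_one₀ (norm_bump_le _) (norm_nonneg _) he1)
  have hx' := norm_nonneg x
  have hb1 : ‖e * x * ((1 - k) * e)‖ ≤ ‖x‖ * √(3 * δ) := by
    refine (norm_mul_le _ _).trans (mul_le_mul ?_ hclose (norm_nonneg _) hx')
    exact (norm_mul_le _ _).trans (mul_le_of_le_one_left hx' he1)
  have hb2 : ‖e * (1 - k) * x * (k * e)‖ ≤ ‖x‖ * √(3 * δ) := by
    refine (norm_mul_le _ _).trans ((mul_le_of_le_one_right (norm_nonneg _) hke1).trans ?_)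
    refine (norm_mul_le _ _).trans ?_
    rw [hnk, mul_comm]
    exact mul_le_mul_of_nonneg_left hclose hx'
  rw [hd1]
  refine (norm_add_le _ _).trans ?_
  have := norm_add_le (e * x * ((1 - k) * e)) (e * (1 - k) * x * (k * e))
  linarith

/-- Adding the scalar `‖x‖ + 1` to `x` only shifts the excision constant. -/
lemma exists_excision_of_isSelfAdjoint {d x : U} (hd : IsPeak d) (hx : IsSelfAdjoint x) {ε : ℝ}
    (hε : 0 < ε) : ∃ d', IsPeak d' ∧ bump d * d' = d' ∧
      ∃ m : ℝ, ‖bump d' * x * bump d' - (m : ℂ) • (bump d' * bump d')‖ ≤ ε := by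
  have h1 : 1 ≤ x + algebraMap ℝ U (‖x‖ + 1) := by
    have h2 := hx.neg_algebraMap_norm_le_self
    rw [map_add, map_one, ← add_assoc]
    have h3 : 0 ≤ x + algebraMap ℝ U ‖x‖ := by
      rw [← sub_neg_eq_add]; exact sub_nonneg.2 h2
    exact le_add_of_nonneg_left h3
  obtain ⟨d', hd', hdd', m, hm⟩ := exists_excision_of_one_le hd h1 hε
  refine ⟨d', hd', hdd', m - (‖x‖ + 1), ?_⟩
  convert hm using 2
  rw [Algebra.algebraMap_eq_smul_one, Complex.coe_smul, Complex.coe_smul]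
  simp only [mul_add, add_mul, mul_smul_comm, smul_mul_assoc, mul_one, sub_smul]
  abel

lemma exists_excision {d : U} (hd : IsPeak d) (z : U) {ε : ℝ} (hε : 0 < ε) :
    ∃ d', IsPeak d' ∧ bump d * d' = d' ∧
      ∃ c : ℂ, ‖bump d' * z * bump d' - c • (bump d' * bump d')‖ ≤ ε := by
  obtain ⟨d₁, hd₁, hdd₁, r, hr⟩ :=
    exists_excision_of_isSelfAdjoint hd (realPart z).2 (half_pos hε)
  obtain ⟨d₂, hd₂, hdd₂, s, hs⟩ :=
    exists_excision_of_isSelfAdjoint hd₁ (imaginaryPart z).2 (half_pos hε)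
  refine ⟨d₂, hd₂, bump_mul_trans hd₁.isSelfAdjoint hdd₁ hdd₂, r + Complex.I * s, ?_⟩
  have hr' := norm_excision_le_of_bump_mul hd₂.isSelfAdjoint hdd₂ hr
  have h1 : bump d₂ * z * bump d₂ - ((r : ℂ) + Complex.I * s) • (bump d₂ * bump d₂) =
      (bump d₂ * (realPart z : U) * bump d₂ - (r : ℂ) • (bump d₂ * bump d₂)) +
      Complex.I • (bump d₂ * (imaginaryPart z : U) * bump d₂ - (s : ℂ) • (bump d₂ * bump d₂)) := by
    conv_lhs => rw [← realPart_add_I_smul_imaginaryPart z]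
    simp only [mul_add, add_mul, mul_smul_comm, smul_mul_assoc, add_smul, smul_sub, mul_smul]
    abel
  rw [h1]
  refine (norm_add_le _ _).trans ?_
  rw [norm_smul, Complex.norm_I, one_mul]
  linarith

/-- Simultaneous excision of finitely many elements. -/
lemma exists_excision_finset {d : U} (hd : IsPeak d) (s : Finset U) {ε : ℝ} (hε : 0 < ε) :
    ∃ d', IsPeak d' ∧ bump d * d' = d' ∧
      ∀ z ∈ s, ∃ c : ℂ, ‖bump d' * z * bump d' - c • (bump d' * bump d')‖ ≤ ε := by
  classical
  induction s using Finset.induction_on with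
  | empty => exact ⟨_, hd.cfc_ramp_half, bump_mul_cfc_ramp_half d, by simp⟩
  | insert z s _ ih =>
    obtain ⟨d₁, hd₁, hdd₁, h₁⟩ := ih
    obtain ⟨d₂, hd₂, hdd₂, c, hc⟩ := exists_excision hd₁ z hε
    refine ⟨d₂, hd₂, bump_mul_trans hd₁.isSelfAdjoint hdd₁ hdd₂, fun w hw => ?_⟩
    rcases Finset.mem_insert.1 hw with rfl | hw
    · exact ⟨c, hc⟩
    · obtain ⟨c', hc'⟩ := h₁ w hw
      exact ⟨c', norm_excision_le_of_bump_mul hd₂.isSelfAdjoint hdd₂ hc'⟩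

end Excision

/-! ### Excision of vector functionals -/

section VectorFunctional

variable {B : Type*} [NonUnitalCStarAlgebra B]

/-- In the unitization `M - b` is of the form `s* s`, and the unital extension of the representation
keeps it positive. -/
lemma HilbertRep.re_inner_rep_le (π : HilbertRep B) (ξ : π.H) {b : B} (hb : IsSelfAdjoint b)
    {M : ℝ} (hM : ∀ t ∈ spectrum ℝ (b : Unitization ℂ B), t ≤ M) :
    (⟪ξ, π.rep b ξ⟫_ℂ).re ≤ M * ‖ξ‖ ^ 2 := by
  let _ := CStarAlgebra.spectralOrder (Unitization ℂ B)
  let _ := CStarAlgebra.spectralOrderedRing (Unitization ℂ B)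
  have h1 : (b : Unitization ℂ B) ≤ algebraMap ℝ _ M := le_algebraMap_of_spectrum_le hM (hb.inr ℂ)
  obtain ⟨s, hs⟩ := CStarAlgebra.nonneg_iff_eq_star_mul_self.1 (sub_nonneg.2 h1)
  let F := Unitization.starLift π.rep
  have h2 : F (algebraMap ℝ (Unitization ℂ B) M - b) = (M : ℂ) • 1 - π.rep b := by
    rw [Algebra.algebraMap_eq_smul_one, ← Complex.coe_smul, map_sub, map_smul, map_one]
    congr 1
    exact DFunLike.congr_fun (Unitization.starLift.symm_apply_apply π.rep) b
  have h3 : 0 ≤ (⟪ξ, F (algebraMap ℝ (Unitization ℂ B) M - b) ξ⟫_ℂ).re := by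
    rw [hs, map_mul, map_star, ContinuousLinearMap.star_eq_adjoint]
    change 0 ≤ (⟪ξ, ContinuousLinearMap.adjoint (F s) (F s ξ)⟫_ℂ).re
    rw [ContinuousLinearMap.adjoint_inner_right]
    exact inner_self_nonneg (𝕜 := ℂ)
  rw [h2] at h3
  have h4 : ((M : ℂ) • (1 : π.H →L[ℂ] π.H) - π.rep b) ξ = (M : ℂ) • ξ - π.rep b ξ := rfl
  rw [h4, inner_sub_right, inner_smul_right, inner_self_eq_norm_sq_to_K] at h3
  simp only [Complex.sub_re, Complex.coe_algebraMap, ← Complex.ofReal_pow, ← Complex.ofReal_mul,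
    Complex.ofReal_re] at h3
  linarith

/-- Start from a peak at the largest spectral value `M` of `b`, which dominates the vector
functional at `b`, and then excise the remaining elements below that peak. Positivity of the
functional at `b` makes `M > 0`, so the cut-offs vanish at `0` and the construction stays inside
`B`. -/
lemma exists_excision_nonunital (π : HilbertRep B) {ξ : π.H} (hξ : ‖ξ‖ ≤ 1) {b : B}
    (hb : IsSelfAdjoint b) (hpos : 0 < (⟪ξ, π.rep b ξ⟫_ℂ).re) (s : Finset B) {ε : ℝ} (hε : 0 < ε) :
    ∃ d : B, IsSelfAdjoint d ∧ cfcₙ (ramp (1 / 2) (1 / 2)) d ≠ 0 ∧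
      (∀ z ∈ s, ∃ c : ℂ, ‖cfcₙ (ramp (1 / 4) (1 / 4)) d * z * cfcₙ (ramp (1 / 4) (1 / 4)) d -
        c • (cfcₙ (ramp (1 / 4) (1 / 4)) d * cfcₙ (ramp (1 / 4) (1 / 4)) d)‖ ≤ ε) ∧
      ∃ M : ℝ, (⟪ξ, π.rep b ξ⟫_ℂ).re ≤ M ∧
        ‖cfcₙ (ramp (1 / 4) (1 / 4)) d * b * cfcₙ (ramp (1 / 4) (1 / 4)) d -
        (M : ℂ) • (cfcₙ (ramp (1 / 4) (1 / 4)) d * cfcₙ (ramp (1 / 4) (1 / 4)) d)‖ ≤ ε := by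
  classical
  let _ := CStarAlgebra.spectralOrder (Unitization ℂ B)
  let _ := CStarAlgebra.spectralOrderedRing (Unitization ℂ B)
  have hbU : IsSelfAdjoint (b : Unitization ℂ B) := hb.inr ℂ
  have hr0 : ∀ {c r : ℝ}, 0 < r → 0 ≤ c → ramp c r 0 = 0 := fun hr hc => ramp_of_le hr hc
  obtain ⟨M, hMmem, hM⟩ := (spectrum.isCompact (𝕜 := ℝ) (b : Unitization ℂ B)).exists_isGreatest
    (ContinuousFunctionalCalculus.spectrum_nonempty _ hbU)
  have hM' : ∀ t ∈ spectrum ℝ (b : Unitization ℂ B), t ≤ M := fun t ht => hM ht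
  have hle := π.re_inner_rep_le ξ hb hM'
  have hM0 : 0 < M := by
    by_contra h
    have := mul_nonpos_of_nonpos_of_nonneg (not_lt.1 h) (sq_nonneg ‖ξ‖)
    linarith
  have hleM : (⟪ξ, π.rep b ξ⟫_ℂ).re ≤ M :=
    hle.trans (mul_le_of_le_one_right hM0.le (pow_le_one₀ (norm_nonneg _) hξ))
  obtain ⟨δ, hδ, hδM, hδε⟩ : ∃ δ : ℝ, 0 < δ ∧ 2 * δ ≤ M ∧ 2 * δ ≤ ε := by
    refine ⟨min (M / 2) (ε / 2), by positivity, ?_, ?_⟩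
    · linarith [min_le_left (M / 2) (ε / 2)]
    · linarith [min_le_right (M / 2) (ε / 2)]
  have hd₀ : IsPeak (cfc (ramp (M - 2 * δ) δ) (b : Unitization ℂ B)) :=
    isPeak_cfc_ramp hδ hMmem (by linarith) hbU
  have hexc := norm_bump_cfc_ramp_le (M := M) hbU hδ fun t ht => (hM' t ht).trans (by linarith)
  set d₀ := cfc (ramp (M - 2 * δ) δ) (b : Unitization ℂ B) with hd₀'
  obtain ⟨d', hd', hdd', hs⟩ := exists_excision_finset hd₀ (s.image (Unitization.inr (R := ℂ))) hε
  -- Since `bump d₀` lies in the ideal `B` of its unitization, so does `d' = bump d₀ * d'`.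
  have hfst : (bump d₀).fst = 0 := by
    rw [hd₀', ← Unitization.real_cfcₙ_eq_cfc_inr _ _ (hr0 hδ (by linarith)), bump,
      ← Unitization.real_cfcₙ_eq_cfc_inr _ _ (hr0 (by norm_num) (by norm_num)), Unitization.fst_inr]
  obtain ⟨d, rfl⟩ : ∃ d : B, (d : Unitization ℂ B) = d' := by
    refine ⟨d'.snd, ?_⟩
    ext
    · rw [Unitization.fst_inr, ← hdd', Unitization.fst_mul, hfst, zero_mul]
    · simp
  have hcfc : ∀ {c r : ℝ}, 0 < r → 0 ≤ c →
      cfc (ramp c r) (d : Unitization ℂ B) = (cfcₙ (ramp c r) d : B) := fun hr hc =>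
    (Unitization.real_cfcₙ_eq_cfc_inr _ _ (hr0 hr hc)).symm
  have hbump : bump (d : Unitization ℂ B) = (cfcₙ (ramp (1 / 4) (1 / 4)) d : B) :=
    hcfc (by norm_num) (by norm_num)
  have key : ∀ (z : B) (c : ℂ), ‖bump (d : Unitization ℂ B) * z * bump (d : Unitization ℂ B) -
      c • (bump (d : Unitization ℂ B) * bump (d : Unitization ℂ B))‖ =
      ‖cfcₙ (ramp (1 / 4) (1 / 4)) d * z * cfcₙ (ramp (1 / 4) (1 / 4)) d -
        c • (cfcₙ (ramp (1 / 4) (1 / 4)) d * cfcₙ (ramp (1 / 4) (1 / 4)) d)‖ := fun z c => by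
    rw [hbump]
    conv_rhs => rw [← Unitization.norm_inr (𝕜 := ℂ)]
    simp only [Unitization.inr_sub, Unitization.inr_mul, Unitization.inr_smul]
  refine ⟨d, ?_, ?_, fun z hz => ?_, M, hleM, ?_⟩
  · exact Unitization.isSelfAdjoint_inr.1 hd'.isSelfAdjoint
  · intro h
    have h1 := hd'.cfc_ramp_half.ne_zero
    rw [hcfc (by norm_num) (by norm_num), h] at h1
    exact h1 (Unitization.inr_zero ℂ)
  · obtain ⟨c, hc⟩ := hs z (Finset.mem_image_of_mem _ hz)
    exact ⟨c, (key z c).symm.trans_le hc⟩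
  · rw [← key]
    exact norm_excision_le_of_bump_mul hd'.isSelfAdjoint hdd' (hexc.trans hδε)

end VectorFunctional

/-! ### Excision of vector functionals of a fibre -/

section RealPart

variable {B : Type*} [NonUnitalCStarAlgebra B]

/-- The local unit relation gives `‖e * e‖ ≥ 1`, so two scalars excising the same element up to
errors differ by at most the sum of these errors. -/
lemma le_re_add_of_excision {e z d : B} (he : IsSelfAdjoint e) (hd : e * d = d) (hd0 : d ≠ 0)
    {M δ₁ δ₂ : ℝ} {c : ℂ} (h₁ : ‖e * (realPart z : B) * e - (M : ℂ) • (e * e)‖ ≤ δ₁)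
    (h₂ : ‖e * z * e - c • (e * e)‖ ≤ δ₂) : M ≤ c.re + δ₁ + δ₂ := by
  have h3 : 1 ≤ ‖e * e‖ := by
    have h4 := norm_mul_le (e * e) d
    rw [mul_assoc, hd, hd] at h4
    exact (le_mul_iff_one_le_left (norm_pos_iff.2 hd0)).1 h4
  set W := e * z * e - c • (e * e) with hW
  have h5 : ((c.re - M : ℝ) : ℂ) • (e * e) = (e * (realPart z : B) * e - (M : ℂ) • (e * e)) -
      (2⁻¹ : ℂ) • (W + star W) := by
    have h6 : star W = e * star z * e - star c • (e * e) := by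
      rw [hW, star_sub, star_smul, star_mul, star_mul, star_mul, he.star_eq, mul_assoc]
    have h7 : ((c.re : ℝ) : ℂ) = 2⁻¹ * (c + star c) := by
      rw [Complex.star_def, Complex.add_conj]; push_cast; ring
    rw [h6, realPart_apply_coe, hW, show ((2⁻¹ : ℝ) • (z + star z)) = (2⁻¹ : ℂ) • (z + star z) by
      rw [show (2⁻¹ : ℂ) = ((2⁻¹ : ℝ) : ℂ) by norm_num, Complex.coe_smul], Complex.ofReal_sub, h7]
    simp only [mul_smul_comm, smul_mul_assoc, mul_add, add_mul]
    module
  have h8 : ‖((c.re - M : ℝ) : ℂ) • (e * e)‖ ≤ δ₁ + δ₂ := by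
    rw [h5]
    refine (norm_sub_le _ _).trans (add_le_add h₁ ?_)
    rw [norm_smul]
    have h9 := norm_add_le W (star W)
    rw [norm_star] at h9
    norm_num
    linarith
  rw [norm_smul, Complex.norm_real, Real.norm_eq_abs] at h8
  have h10 : |c.re - M| ≤ δ₁ + δ₂ := (le_mul_of_one_le_right (abs_nonneg _) h3).trans h8
  linarith [neg_abs_le (c.re - M)]

lemma HilbertRep.re_inner_rep_realPart (π : HilbertRep B) (ξ : π.H) (z : B) :
    (⟪ξ, π.rep (realPart z : B) ξ⟫_ℂ).re = (⟪ξ, π.rep z ξ⟫_ℂ).re := by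
  have h1 : (⟪ξ, π.rep (star z) ξ⟫_ℂ).re = (⟪ξ, π.rep z ξ⟫_ℂ).re := by
    rw [← π.inner_rep]
    exact inner_re_symm (𝕜 := ℂ) _ _
  rw [realPart_apply_coe, show ((2⁻¹ : ℝ) • (z + star z)) = (2⁻¹ : ℂ) • (z + star z) by
      rw [show (2⁻¹ : ℂ) = ((2⁻¹ : ℝ) : ℂ) by norm_num, Complex.coe_smul], map_smul, map_add,
      smul_apply, add_apply, inner_smul_right, inner_add_right,
      show (2⁻¹ : ℂ) = ((2⁻¹ : ℝ) : ℂ) by norm_num, Complex.re_ofReal_mul, Complex.add_re, h1]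
  ring

end RealPart

namespace CXAlgebra

variable {X : Type*} [TopologicalSpace X] [CompactSpace X] [T2Space X]
variable {A : Type*} [NonUnitalCStarAlgebra A] [CXAlgebra X A]

variable (A) in
/-- The quotient map onto the fibre as a morphism of C*-algebras. -/
def fibreHom (x : X) : A →⋆ₙₐ[ℂ] Fibre A x where
  toFun := fibreMap A x
  map_smul' c a := map_smul (fibreMap A x) c a
  map_zero' := map_zero (fibreMap A x)
  map_add' a b := map_add (fibreMap A x) a b
  map_mul' := fibreMap_mul x
  map_star' := fibreMap_star x

/-- The fibre norm is a quotient norm, so smallness at `x` becomes smallness in `A` after localising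
near `x`; products of the localising functions treat finitely many elements. -/
lemma exists_norm_act_lt (x : X) {ε : ℝ} (s : Finset A) (hs : ∀ c ∈ s, ‖fibreMap A x c‖ < ε) :
    ∃ g : C(X, ℂ), ‖g‖ ≤ 1 ∧ g x = 1 ∧ ∀ c ∈ s, ‖act g c‖ < ε := by
  classical
  have key : ∀ (f : C(X, ℂ)) (b : A), ‖f‖ ≤ 1 → ‖act f b‖ ≤ ‖b‖ := fun f b hf =>
    (norm_act_le f b).trans (mul_le_of_le_one_left (norm_nonneg _) hf)
  induction s using Finset.induction_on with
  | empty =>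
    exact ⟨1, (ContinuousMap.norm_le _ zero_le_one).2 fun y => by simp, rfl, by simp⟩
  | insert c s _ ih =>
    obtain ⟨g, hg, hgx, hgs⟩ := ih fun c hc => hs c (Finset.mem_insert_of_mem hc)
    have hc := hs c (Finset.mem_insert_self _ _)
    obtain ⟨c', hc', hcn⟩ := exists_norm_lt x (fibreMap A x c) (half_pos (sub_pos.2 hc))
    have hmem : c - c' ∈ (fibreIdeal A x).toSubmodule := ((fibreIdeal A x).proj_eq_proj).1 hc'.symm
    obtain ⟨f, hf, hfx, hfs⟩ := exists_small x hmem _ (half_pos (sub_pos.2 hc))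
    have hfc : ‖act f c‖ < ε := by
      have h1 : act f c = act f (c - c') + act f c' := by rw [← map_add, sub_add_cancel]
      rw [h1]
      linarith [norm_add_le (act f (c - c')) (act f c'), key f c' hf]
    refine ⟨g * f, (norm_mul_le _ _).trans (mul_le_one₀ hg (norm_nonneg _) hf), by simp [hgx, hfx],
      fun b hb => ?_⟩
    rcases Finset.mem_insert.1 hb with rfl | hb
    · rw [← act_act]; exact (key g _ hg).trans_lt hfc
    · rw [mul_comm, ← act_act]; exact (key f _ hf).trans_lt (hgs b hb)

/-- Cutting off `|g|` yields functions with `h * h' = h'`. On the support of `h` one has `|g| ≥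
1/4`, so `h` is a multiple of `|g|²` with coefficient at most `16`; this is the constant. -/
lemma exists_plateau (x : X) {ε : ℝ} (s : Finset A) (hs : ∀ c ∈ s, ‖fibreMap A x c‖ < ε) :
    ∃ h h' : C(X, ℂ), ‖h‖ ≤ 1 ∧ h * h' = h' ∧ h' x = 1 ∧
      ∀ c ∈ s, ‖act h c‖ ≤ 16 * ε := by
  obtain ⟨g, hg, hgx, hgs⟩ := exists_norm_act_lt x s hs
  have hg1 : ∀ y, ‖g y‖ ≤ 1 := fun y => (g.norm_coe_le_norm y).trans hg
  let h : C(X, ℂ) := ⟨fun y => (ramp (1 / 4) (1 / 4) ‖g y‖ : ℂ),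
    Complex.continuous_ofReal.comp ((continuous_ramp _ _).comp (by fun_prop))⟩
  let h' : C(X, ℂ) := ⟨fun y => (ramp (1 / 2) (1 / 2) ‖g y‖ : ℂ),
    Complex.continuous_ofReal.comp ((continuous_ramp _ _).comp (by fun_prop))⟩
  have hm : ∀ y, 0 < max (‖g y‖ ^ 2) (1 / 16) := fun y => lt_max_of_lt_right (by norm_num)
  let v : C(X, ℂ) := ⟨fun y => ((ramp (1 / 4) (1 / 4) ‖g y‖ / max (‖g y‖ ^ 2) (1 / 16) : ℝ) : ℂ),
    Complex.continuous_ofReal.comp (((continuous_ramp _ _).comp (by fun_prop)).div (by fun_prop)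
      fun y => (hm y).ne')⟩
  have hfac : h = v * star g * g := by
    ext y
    change (ramp (1 / 4) (1 / 4) ‖g y‖ : ℂ) =
      ((ramp (1 / 4) (1 / 4) ‖g y‖ / max (‖g y‖ ^ 2) (1 / 16) : ℝ) : ℂ) * star (g y) * g y
    rw [mul_assoc, Complex.star_def, Complex.conj_mul', ← Complex.ofReal_pow, ← Complex.ofReal_mul,
      Complex.ofReal_inj]
    rcases le_total ‖g y‖ (1 / 4) with h | h
    · rw [ramp_of_le (by norm_num) h]; simp
    · rw [max_eq_left (by nlinarith), div_mul_cancel₀]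
      exact pow_ne_zero 2 (by linarith)
  have hv : ‖v‖ ≤ 16 := by
    refine (ContinuousMap.norm_le _ (by norm_num)).2 fun y => ?_
    change ‖((ramp (1 / 4) (1 / 4) ‖g y‖ / max (‖g y‖ ^ 2) (1 / 16) : ℝ) : ℂ)‖ ≤ 16
    rw [Complex.norm_real, Real.norm_of_nonneg (div_nonneg (ramp_nonneg _ _ _) (hm y).le),
      div_le_iff₀ (hm y)]
    have := le_max_right (‖g y‖ ^ 2) (1 / 16)
    linarith [ramp_le_one (1 / 4) (1 / 4) ‖g y‖]
  refine ⟨h, h', ?_, ?_, ?_, fun c hc => ?_⟩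
  · refine (ContinuousMap.norm_le _ zero_le_one).2 fun y => ?_
    change ‖(ramp (1 / 4) (1 / 4) ‖g y‖ : ℂ)‖ ≤ 1
    rw [Complex.norm_real]; exact abs_ramp_le_one _ _ _
  · ext y
    change (ramp (1 / 4) (1 / 4) ‖g y‖ : ℂ) * (ramp (1 / 2) (1 / 2) ‖g y‖ : ℂ) =
      (ramp (1 / 2) (1 / 2) ‖g y‖ : ℂ)
    rw [← Complex.ofReal_mul, ramp_quarter_mul_ramp_half]
  · change (ramp (1 / 2) (1 / 2) ‖g x‖ : ℂ) = 1
    rw [hgx, norm_one, ramp_of_ge (by norm_num) (by norm_num), Complex.ofReal_one]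
  · rw [hfac, ← act_act]
    refine (norm_act_le _ _).trans ?_
    refine mul_le_mul ((norm_mul_le _ _).trans ?_) (hgs c hc).le (norm_nonneg _) (by norm_num)
    rw [norm_star]
    nlinarith [norm_nonneg v, norm_nonneg g]

/-- Excision of a vector functional of the fibre at `x`, up to a given precision and on given
elements, by an element of the whole algebra. -/
lemma exists_fibre_excision (x : X) (π : HilbertRep (Fibre A x)) {ξ : π.H} (hξ : ‖ξ‖ ≤ 1)
    {ι : Type*} [Fintype ι] (a : ι → A) (c : ι → ℂ)
    (hpos : 0 < (∑ i, c i * ⟪ξ, π.rep (fibreMap A x (a i)) ξ⟫_ℂ).re) {ε : ℝ} (hε : 0 < ε) :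
    ∃ (e d : A) (l : ι → ℂ), ‖e‖ ≤ 1 ∧ e * d = d ∧ fibreMap A x d ≠ 0 ∧
      (∀ i, ‖e * a i * e - l i • (e * e)‖ ≤ ε) ∧
      (∑ i, c i * ⟪ξ, π.rep (fibreMap A x (a i)) ξ⟫_ℂ).re ≤ (∑ i, c i * l i).re + ε := by
  classical
  have hC : 0 < 1 + ∑ i, ‖c i‖ := by positivity
  -- The plateau costs a factor `16`, and its strict hypothesis is met with `2δ`, hence `32`; the
  -- sum absorbs the coefficients `c i`.
  set δ := ε / (32 * (1 + ∑ i, ‖c i‖)) with hδ'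
  have hδ : 0 < δ := by positivity
  have hδε : 32 * δ * (1 + ∑ i, ‖c i‖) = ε := by rw [hδ']; field_simp
  have hδ1 : 32 * δ ≤ ε := by
    rw [← hδε]
    exact le_mul_of_one_le_right (by positivity) (by
      linarith [Finset.sum_nonneg fun i (_ : i ∈ Finset.univ) => norm_nonneg (c i)])
  set z : Fibre A x := ∑ i, c i • fibreMap A x (a i) with hz
  have hφz : ⟪ξ, π.rep z ξ⟫_ℂ = ∑ i, c i * ⟪ξ, π.rep (fibreMap A x (a i)) ξ⟫_ℂ := by
    rw [hz, map_sum, sum_apply, inner_sum]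
    refine Finset.sum_congr rfl fun i _ => ?_
    rw [map_smul, smul_apply, inner_smul_right]
  rw [← hφz, ← π.re_inner_rep_realPart] at hpos ⊢
  -- Excising at the top of the spectrum of `realPart z` keeps the prescribed linear combination
  -- from decreasing.
  obtain ⟨d₀, hd₀, hne, hs, M, hM, hMe⟩ := exists_excision_nonunital π hξ (realPart z).2 hpos
    (Finset.univ.image fun i => fibreMap A x (a i)) hδ
  choose l hl using fun i => hs (fibreMap A x (a i)) (Finset.mem_image_of_mem _ (Finset.mem_univ i))
  set e₀ := cfcₙ (ramp (1 / 4) (1 / 4)) d₀ with he₀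
  have he₀sa : IsSelfAdjoint e₀ := cfcₙ_predicate _ _
  have hr0 : ∀ {c r : ℝ}, 0 < r → 0 ≤ c → ramp c r 0 = 0 := fun hr hc => ramp_of_le hr hc
  have hmul : ∀ {C : Type _} [NonUnitalCStarAlgebra C] (d : C),
      cfcₙ (ramp (1 / 4) (1 / 4)) d * cfcₙ (ramp (1 / 2) (1 / 2)) d =
        cfcₙ (ramp (1 / 2) (1 / 2)) d := fun d => by
    rw [← cfcₙ_mul _ _ d (continuous_ramp _ _).continuousOn (hr0 (by norm_num) (by norm_num))
      (continuous_ramp _ _).continuousOn (hr0 (by norm_num) (by norm_num))]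
    simp only [ramp_quarter_mul_ramp_half]
  have hW : ‖e₀ * z * e₀ - (∑ i, c i * l i) • (e₀ * e₀)‖ ≤ (∑ i, ‖c i‖) * δ := by
    have h1 : e₀ * z * e₀ - (∑ i, c i * l i) • (e₀ * e₀) =
        ∑ i, c i • (e₀ * fibreMap A x (a i) * e₀ - l i • (e₀ * e₀)) := by
      rw [hz, Finset.mul_sum, Finset.sum_mul, Finset.sum_smul, ← Finset.sum_sub_distrib]
      refine Finset.sum_congr rfl fun i _ => ?_
      rw [smul_sub, mul_smul_comm, smul_mul_assoc, mul_smul]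
    rw [h1, Finset.sum_mul]
    refine norm_sum_le_of_le _ fun i _ => ?_
    rw [norm_smul]
    exact mul_le_mul_of_nonneg_left (hl i) (norm_nonneg _)
  have hMle := le_re_add_of_excision he₀sa (hmul d₀) hne hMe hW
  -- A self-adjoint lift suffices: functional calculus commutes with the quotient map, so the local
  -- unit relation lifts exactly and only the excision estimates need localising near `x`.
  obtain ⟨D, hD, hDd⟩ : ∃ D : A, IsSelfAdjoint D ∧ fibreHom A x D = d₀ := by
    obtain ⟨D, hD⟩ := (fibreIdeal A x).proj_surjective d₀
    refine ⟨realPart D, (realPart D).2, ?_⟩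
    change fibreHom A x D = d₀ at hD
    have h2 : ∀ {C : Type _} [NonUnitalCStarAlgebra C] (z : C),
        (realPart z : C) = (2⁻¹ : ℂ) • (z + star z) := fun z => by
      rw [realPart_apply_coe, show (2⁻¹ : ℂ) = ((2⁻¹ : ℝ) : ℂ) by norm_num, Complex.coe_smul]
    rw [h2, map_smul, map_add, map_star, hD, ← h2, hd₀.coe_realPart]
  have hcont : Continuous (fibreHom A x) :=
    AddMonoidHomClass.continuous_of_bound (fibreHom A x) 1 fun a => by
      rw [one_mul]; exact norm_fibreMap_le x a
  have hmap : ∀ {c r : ℝ}, 0 < r → 0 ≤ c →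
      fibreHom A x (cfcₙ (ramp c r) D) = cfcₙ (ramp c r) d₀ := fun {c r} hr hc => by
    rw [NonUnitalStarAlgHom.map_cfcₙ (fibreHom A x) (ramp c r) D (continuous_ramp _ _).continuousOn
      (hr0 hr hc) hcont hD (hDd ▸ hd₀), hDd]
  set e₁ := cfcₙ (ramp (1 / 4) (1 / 4)) D with he₁
  have he₁n : ‖e₁‖ ≤ 1 := norm_cfcₙ_le fun _ _ => abs_ramp_le_one _ _ _
  have hσe : fibreHom A x e₁ = e₀ := hmap (by norm_num) (by norm_num)
  obtain ⟨h, h', hn, hhh', hh'x, hsmall⟩ := exists_plateau x (ε := 2 * δ)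
    (Finset.univ.image fun i => e₁ * a i * e₁ - l i • (e₁ * e₁)) (by
      intro w hw
      obtain ⟨i, -, rfl⟩ := Finset.mem_image.1 hw
      change ‖fibreHom A x (e₁ * a i * e₁ - l i • (e₁ * e₁))‖ < 2 * δ
      rw [map_sub, map_smul, map_mul, map_mul, map_mul, hσe]
      exact (hl i).trans_lt (by linarith))
  refine ⟨act h e₁, act h' (cfcₙ (ramp (1 / 2) (1 / 2)) D), l, ?_, ?_, ?_, fun i => ?_, ?_⟩
  · exact (norm_act_le _ _).trans (mul_le_one₀ hn (norm_nonneg _) he₁n)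
  · rw [← act_mul_left, ← act_mul_right, act_act, hmul, hhh']
  · rw [fibreMap_act x h' hh'x]
    change fibreHom A x _ ≠ 0
    rwa [hmap (by norm_num) (by norm_num)]
  · have h1 : act h e₁ * a i * act h e₁ - l i • (act h e₁ * act h e₁) =
        act h (act h (e₁ * a i * e₁ - l i • (e₁ * e₁))) := by
      rw [map_sub, map_sub, map_smul, map_smul, ← act_mul_right, ← act_mul_left, ← act_mul_left,
        ← act_mul_right, ← act_mul_left]
    rw [h1]
    refine (norm_act_le _ _).trans ((mul_le_of_le_one_left (norm_nonneg _) hn).trans ?_)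
    refine (hsmall _ (Finset.mem_image_of_mem _ (Finset.mem_univ i))).trans (by linarith)
  · have h1 : δ + (∑ i, ‖c i‖) * δ ≤ ε := by
      have : 0 ≤ δ * (1 + ∑ i, ‖c i‖) := by positivity
      nlinarith
    linarith

end CXAlgebra

/-! ### Minimality -/

section Minimality

variable {A B : Type*} [NonUnitalCStarAlgebra A] [NonUnitalCStarAlgebra B]

/-- `(e₁ * e₁) ⊗ (e₂ * e₂)` fixes `d₁ ⊗ d₂`, so its seminorm is at least `1`, and `∑ lᵢ mᵢ` times it
is nearly the compression of `∑ aᵢ ⊗ bᵢ` by `e₁ ⊗ e₂`. The subcross property controls the errors. -/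
lemma IsCStarSeminorm.norm_sum_mul_le_of_excision {q : Seminorm ℂ (A ⊗[ℂ] B)}
    (hq : IsCStarSeminorm q) {e₁ d₁ : A} {e₂ d₂ : B} (he₁ : ‖e₁‖ ≤ 1) (he₂ : ‖e₂‖ ≤ 1)
    (hd₁ : e₁ * d₁ = d₁) (hd₂ : e₂ * d₂ = d₂) (hd : q (d₁ ⊗ₜ d₂) ≠ 0) {ι : Type*} [Fintype ι]
    {a : ι → A} {b : ι → B} {l m : ι → ℂ} {ε₁ ε₂ : ℝ}
    (h₁ : ∀ i, ‖e₁ * a i * e₁ - l i • (e₁ * e₁)‖ ≤ ε₁)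
    (h₂ : ∀ i, ‖e₂ * b i * e₂ - m i • (e₂ * e₂)‖ ≤ ε₂) :
    ‖∑ i, l i * m i‖ ≤ q (∑ i, a i ⊗ₜ b i) + ε₁ * ∑ i, ‖b i‖ + ε₂ * ∑ i, ‖l i‖ := by
  have hone : 1 ≤ q ((e₁ * e₁) ⊗ₜ (e₂ * e₂)) := by
    have h := hq.mul_le ((e₁ * e₁) ⊗ₜ (e₂ * e₂)) (d₁ ⊗ₜ d₂)
    rw [Algebra.TensorProduct.tmul_mul_tmul, mul_assoc, hd₁, hd₁, mul_assoc, hd₂, hd₂] at h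
    exact (le_mul_iff_one_le_left ((apply_nonneg _ _).lt_of_ne' hd)).1 h
  have hsq : ‖e₁ * e₁‖ ≤ 1 := (norm_mul_le _ _).trans (mul_le_one₀ he₁ (norm_nonneg _) he₁)
  have he : q (e₁ ⊗ₜ e₂) ≤ 1 := (hq.tmul_le _ _).trans (mul_le_one₀ he₁ (norm_nonneg _) he₂)
  have hα : q (e₁ ⊗ₜ e₂ * (∑ i, a i ⊗ₜ b i) * e₁ ⊗ₜ e₂) ≤ q (∑ i, a i ⊗ₜ b i) := by
    refine (hq.mul_le _ _).trans ((mul_le_of_le_one_right (apply_nonneg _ _) he).trans ?_)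
    exact (hq.mul_le _ _).trans (mul_le_of_le_one_left (apply_nonneg _ _) he)
  have hdec : (∑ i, l i * m i) • ((e₁ * e₁) ⊗ₜ[ℂ] (e₂ * e₂)) =
      e₁ ⊗ₜ e₂ * (∑ i, a i ⊗ₜ b i) * e₁ ⊗ₜ e₂ -
      ((∑ i, (e₁ * a i * e₁ - l i • (e₁ * e₁)) ⊗ₜ[ℂ] (e₂ * b i * e₂)) +
        ∑ i, l i • ((e₁ * e₁) ⊗ₜ[ℂ] (e₂ * b i * e₂ - m i • (e₂ * e₂)))) := by
    rw [Finset.mul_sum, Finset.sum_mul, Finset.sum_smul, ← Finset.sum_add_distrib,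
      ← Finset.sum_sub_distrib]
    refine Finset.sum_congr rfl fun i _ => ?_
    simp only [Algebra.TensorProduct.tmul_mul_tmul, TensorProduct.sub_tmul, TensorProduct.tmul_sub,
      TensorProduct.tmul_smul, ← TensorProduct.smul_tmul', smul_sub, smul_smul]
    abel
  have hs₁ : q (∑ i, (e₁ * a i * e₁ - l i • (e₁ * e₁)) ⊗ₜ[ℂ] (e₂ * b i * e₂)) ≤
      ε₁ * ∑ i, ‖b i‖ := by
    rw [Finset.mul_sum]
    refine (Finset.le_sum_of_subadditive q (map_zero q).le (map_add_le_add q) _ _).trans (Finset.sum_le_sum fun i _ => (hq.tmul_le _ _).trans ?_)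
    refine mul_le_mul (h₁ i) ?_ (norm_nonneg _) ((norm_nonneg _).trans (h₁ i))
    refine (norm_mul_le _ _).trans ((mul_le_of_le_one_right (norm_nonneg _) he₂).trans ?_)
    exact (norm_mul_le _ _).trans (mul_le_of_le_one_left (norm_nonneg _) he₂)
  have hs₂ : q (∑ i, l i • ((e₁ * e₁) ⊗ₜ[ℂ] (e₂ * b i * e₂ - m i • (e₂ * e₂)))) ≤
      ε₂ * ∑ i, ‖l i‖ := by
    rw [Finset.mul_sum]
    refine (Finset.le_sum_of_subadditive q (map_zero q).le (map_add_le_add q) _ _).trans (Finset.sum_le_sum fun i _ => ?_)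
    rw [map_smul_eq_mul, mul_comm]
    refine mul_le_mul_of_nonneg_right ((hq.tmul_le _ _).trans ?_) (norm_nonneg _)
    exact (mul_le_of_le_one_left (norm_nonneg _) hsq).trans (h₂ i)
  calc ‖∑ i, l i * m i‖ ≤ ‖∑ i, l i * m i‖ * q ((e₁ * e₁) ⊗ₜ (e₂ * e₂)) :=
        le_mul_of_one_le_right (norm_nonneg _) hone
    _ = q ((∑ i, l i * m i) • ((e₁ * e₁) ⊗ₜ[ℂ] (e₂ * e₂))) := (map_smul_eq_mul _ _ _).symm
    _ ≤ _ := by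
      rw [hdec]
      have h3 := map_sub_le_add q (e₁ ⊗ₜ e₂ * (∑ i, a i ⊗ₜ b i) * e₁ ⊗ₜ e₂)
        ((∑ i, (e₁ * a i * e₁ - l i • (e₁ * e₁)) ⊗ₜ[ℂ] (e₂ * b i * e₂)) +
        ∑ i, l i • ((e₁ * e₁) ⊗ₜ[ℂ] (e₂ * b i * e₂ - m i • (e₂ * e₂))))
      have h4 := map_add_le_add q
        (∑ i, (e₁ * a i * e₁ - l i • (e₁ * e₁)) ⊗ₜ[ℂ] (e₂ * b i * e₂))
        (∑ i, l i • ((e₁ * e₁) ⊗ₜ[ℂ] (e₂ * b i * e₂ - m i • (e₂ * e₂))))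
      linarith

lemma le_of_forall_pow_two_pow_le {s r C : ℝ} (hr : 0 ≤ r)
    (h : ∀ n : ℕ, s ^ 2 ^ n ≤ C * r ^ 2 ^ n) : s ≤ r := by
  by_contra! hlt
  rcases hr.eq_or_lt with rfl | hr
  · have := h 0
    simp only [pow_zero, pow_one, mul_zero] at this
    linarith
  have h1 : 1 < s / r := (one_lt_div hr).2 hlt
  obtain ⟨n, hn⟩ := pow_unbounded_of_one_lt C h1
  have h2 := h n
  rw [← div_le_iff₀ (by positivity), ← div_pow] at h2
  have h3 : (s / r) ^ n ≤ (s / r) ^ 2 ^ n := pow_le_pow_right₀ h1.le Nat.lt_two_pow_self.le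
  linarith

lemma exists_eq_smul_of_norm_le_one {V : Type*} [NormedAddCommGroup V] [NormedSpace ℂ V] (v : V) :
    ∃ (c : ℂ) (w : V), ‖w‖ ≤ 1 ∧ v = c • w := by
  rcases eq_or_ne v 0 with rfl | hv
  · exact ⟨0, 0, by simp, by simp⟩
  · have hv' : (‖v‖ : ℂ) ≠ 0 := Complex.ofReal_ne_zero.2 (norm_ne_zero_iff.2 hv)
    refine ⟨‖v‖, (‖v‖ : ℂ)⁻¹ • v, ?_, by rw [smul_smul, mul_inv_cancel₀ hv', one_smul]⟩
    rw [norm_smul, norm_inv, Complex.norm_real, norm_norm, inv_mul_cancel₀ (norm_ne_zero_iff.2 hv)]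

lemma TensorProduct.tmul_ne_zero_of_ne_zero {V W : Type*} [AddCommGroup V] [Module ℂ V]
    [AddCommGroup W] [Module ℂ W] {v : V} {w : W} (hv : v ≠ 0) (hw : w ≠ 0) :
    v ⊗ₜ[ℂ] w ≠ 0 := fun h => by
  obtain ⟨f, hf⟩ : ∃ f : Module.Dual ℂ V, f v ≠ 0 := by
    by_contra! hf
    exact hv ((Module.forall_dual_apply_eq_zero_iff ℂ v).1 hf)
  have h1 := congrArg (fun t => TensorProduct.lid ℂ W (f.rTensor W t)) h
  simp only [LinearMap.rTensor_tmul, TensorProduct.lid_tmul, map_zero] at h1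
  exact (smul_ne_zero hf hw) h1

/-- A Cauchy–Schwarz iteration: if the vectors `(π₁ ⊗ π₂)(f(α)) ζ` are bounded by a multiple of a
C*-seminorm of `α`, then the multiple may be taken to be `‖ζ‖`. -/
lemma HilbertRep.norm_tensor_apply_le_of_bound {D : Type*} [NonUnitalRing D] [StarRing D]
    [Module ℂ D] {q : Seminorm ℂ D} (hq : IsCStarSeminorm q) (π₁ : HilbertRep A)
    (π₂ : HilbertRep B) (f : D → A ⊗[ℂ] B) (hmul : ∀ α β, f (α * β) = f α * f β)
    (hstar : ∀ α, f (star α) = star (f α)) (ζ : π₁.H ⊗[ℂ] π₂.H) {C : ℝ}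
    (hC : ∀ α, ‖π₁.tensor π₂ (f α) ζ‖ ≤ C * q α) (α : D) :
    ‖π₁.tensor π₂ (f α) ζ‖ ≤ q α * ‖ζ‖ := by
  have hsq : ∀ β : D, ‖π₁.tensor π₂ (f β) ζ‖ ^ 2 ≤ ‖ζ‖ * ‖π₁.tensor π₂ (f (star β * β)) ζ‖ :=
    fun β => by rw [hmul, hstar]; exact π₁.norm_tensor_apply_sq_le π₂ _ ζ
  rcases eq_or_ne ζ 0 with rfl | hζ
  · simp
  have hζ0 : 0 < ‖ζ‖ := norm_pos_iff.2 hζ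
  -- Along this iteration `q` is squared exactly, while `‖T ζ‖ / ‖ζ‖` is at least squared.
  let g : ℕ → D := fun n => Nat.rec α (fun _ β => star β * β) n
  have hg : ∀ n, g (n + 1) = star (g n) * g n := fun _ => rfl
  have hqg : ∀ n, q (g n) = q α ^ 2 ^ n := fun n => by
    induction n with
    | zero => simp [g]
    | succ n ih => rw [hg, hq.star_mul_self, ih, ← pow_mul, pow_succ]
  have hTg : ∀ n, (‖π₁.tensor π₂ (f α) ζ‖ / ‖ζ‖) ^ 2 ^ n ≤
      ‖π₁.tensor π₂ (f (g n)) ζ‖ / ‖ζ‖ := fun n => by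
    induction n with
    | zero => simp [g]
    | succ n ih =>
      rw [pow_succ 2, pow_mul]
      refine (pow_le_pow_left₀ (by positivity) ih 2).trans ?_
      rw [div_pow, div_le_div_iff₀ (by positivity) hζ0, hg]
      have := hsq (g n)
      nlinarith
  rw [← div_le_iff₀ hζ0]
  refine le_of_forall_pow_two_pow_le (C := C / ‖ζ‖) (apply_nonneg _ _) fun n => ?_
  refine (hTg n).trans ?_
  rw [← hqg, div_mul_eq_mul_div]
  exact div_le_div_of_nonneg_right (hC _) hζ0.le

end Minimality

/-! ### Domination of the minimal norms of the fibres -/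

namespace CXAlgebra

variable {X : Type*} [TopologicalSpace X] [CompactSpace X] [T2Space X]
variable {A : Type*} [NonUnitalCStarAlgebra A] [CXAlgebra X A]
variable {B : Type*} [NonUnitalCStarAlgebra B] [CXAlgebra X B]

/-- The functionals are replaced one at a time: the coefficients of the first excision are the
values of the second functional, and those of the second are the scalars `l` already obtained. -/
lemma re_sum_inner_mul_inner_le {q : Seminorm ℂ (A ⊗[ℂ] B)} (hq : IsCStarSeminorm q) (x : X)
    (hqx : ∀ (a : A) (b : B), fibreMap A x a ≠ 0 → fibreMap B x b ≠ 0 → q (a ⊗ₜ b) ≠ 0)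
    (π₁ : HilbertRep (Fibre A x)) (π₂ : HilbertRep (Fibre B x)) {ξ : π₁.H} {η : π₂.H}
    (hξ : ‖ξ‖ ≤ 1) (hη : ‖η‖ ≤ 1) {ι : Type*} [Fintype ι] (a : ι → A) (b : ι → B) :
    (∑ i, ⟪ξ, π₁.rep (fibreMap A x (a i)) ξ⟫_ℂ * ⟪η, π₂.rep (fibreMap B x (b i)) η⟫_ℂ).re ≤
      q (∑ i, a i ⊗ₜ b i) := by
  refine le_of_forall_pos_le_add fun ε hε => ?_
  have hq0 := apply_nonneg q (∑ i, a i ⊗ₜ[ℂ] b i)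
  simp only [mul_comm ⟪ξ, _⟫_ℂ]
  set t := (∑ i, ⟪η, π₂.rep (fibreMap B x (b i)) η⟫_ℂ *
    ⟪ξ, π₁.rep (fibreMap A x (a i)) ξ⟫_ℂ).re with ht
  -- Excision needs a positive value; otherwise the bound is trivial because `q ≥ 0`.
  rcases le_or_gt t 0 with ht0 | ht0
  · linarith
  have hb : 0 < 1 + ∑ i, ‖b i‖ := by positivity
  obtain ⟨e₁, d₁, l, he₁, hd₁, hσ₁, hl, hle₁⟩ := exists_fibre_excision x π₁ hξ a
    (fun i => ⟪η, π₂.rep (fibreMap B x (b i)) η⟫_ℂ) ht0 (ε := ε / 2 / (1 + ∑ i, ‖b i‖))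
    (by positivity)
  set ε₁ := ε / 2 / (1 + ∑ i, ‖b i‖) with hε₁
  have hε₁' : ε₁ * (1 + ∑ i, ‖b i‖) = ε / 2 := div_mul_cancel₀ _ hb.ne'
  have hε₁p : 0 < ε₁ := by positivity
  have hbs : 0 ≤ ε₁ * ∑ i, ‖b i‖ := by positivity
  simp only [mul_comm _ (l _)] at hle₁
  rcases le_or_gt (∑ i, l i * ⟪η, π₂.rep (fibreMap B x (b i)) η⟫_ℂ).re 0 with hs0 | hs0
  · linarith
  have hls : 0 < 1 + ∑ i, ‖l i‖ := by positivity
  obtain ⟨e₂, d₂, m, he₂, hd₂, hσ₂, hm, hle₂⟩ := exists_fibre_excision x π₂ hη b l hs0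
    (ε := ε / 2 / (1 + ∑ i, ‖l i‖)) (by positivity)
  set ε₂ := ε / 2 / (1 + ∑ i, ‖l i‖) with hε₂
  have hε₂' : ε₂ * (1 + ∑ i, ‖l i‖) = ε / 2 := div_mul_cancel₀ _ hls.ne'
  have hfin := hq.norm_sum_mul_le_of_excision he₁ he₂ hd₁ hd₂ (hqx d₁ d₂ hσ₁ hσ₂) hl hm
  have hre := Complex.re_le_norm (∑ i, l i * m i)
  linarith

lemma norm_tensor_tmul_le {q : Seminorm ℂ (A ⊗[ℂ] B)} (hq : IsCStarSeminorm q) (x : X)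
    (hqx : ∀ (a : A) (b : B), fibreMap A x a ≠ 0 → fibreMap B x b ≠ 0 → q (a ⊗ₜ b) ≠ 0)
    (π₁ : HilbertRep (Fibre A x)) (π₂ : HilbertRep (Fibre B x)) {ξ : π₁.H} {η : π₂.H}
    (hξ : ‖ξ‖ ≤ 1) (hη : ‖η‖ ≤ 1) (α : A ⊗[ℂ] B) :
    ‖π₁.tensor π₂ (fibreTensorMap A B x α) (ξ ⊗ₜ η)‖ ≤ q α := by
  refine (pow_le_pow_iff_left₀ (norm_nonneg _) (apply_nonneg _ _) two_ne_zero).1 ?_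
  rw [HilbertRep.norm_tensor_apply_sq, ← fibreTensorMap_star, ← fibreTensorMap_mul,
    ← hq.star_mul_self]
  obtain ⟨n, a, b, h⟩ := exists_eq_sum_tmul (star α * α)
  rw [h]
  refine le_of_eq_of_le ?_ (re_sum_inner_mul_inner_le hq x hqx π₁ π₂ hξ hη a b)
  congr 1
  rw [map_sum, map_sum, sum_apply, inner_sum]
  refine Finset.sum_congr rfl fun i _ => ?_
  exact TensorProduct.inner_tmul ℂ _ _ _ _

/-- A C*-seminorm which is positive on the elementary tensors that do not vanish at `x` dominates
the minimal norm of the fibre at `x`. -/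
lemma minTensorNorm_fibre_le {q : Seminorm ℂ (A ⊗[ℂ] B)} (hq : IsCStarSeminorm q) (x : X)
    (hqx : ∀ (a : A) (b : B), fibreMap A x a ≠ 0 → fibreMap B x b ≠ 0 → q (a ⊗ₜ b) ≠ 0)
    (α : A ⊗[ℂ] B) : minTensorNorm (fibreTensorMap A B x α) ≤ q α := by
  refine Real.iSup_le (fun π => ?_) (apply_nonneg _ _)
  obtain ⟨π₁, π₂⟩ := π
  refine ContinuousLinearMap.opNorm_le_bound _ (apply_nonneg _ _) fun ζ => ?_
  -- The constant may depend on `ζ`, so sums of elementary tensors are harmless.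
  suffices ∃ C : ℝ, ∀ α, ‖π₁.tensor π₂ (fibreTensorMap A B x α) ζ‖ ≤ C * q α by
    obtain ⟨C, hC⟩ := this
    exact HilbertRep.norm_tensor_apply_le_of_bound hq π₁ π₂ (fibreTensorMap A B x)
      (fibreTensorMap_mul x) (fibreTensorMap_star x) ζ hC α
  induction ζ with
  | zero => exact ⟨0, by simp⟩
  | add ζ₁ ζ₂ h₁ h₂ =>
    obtain ⟨C₁, h₁⟩ := h₁
    obtain ⟨C₂, h₂⟩ := h₂
    refine ⟨C₁ + C₂, fun α => ?_⟩
    rw [map_add, add_mul]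
    exact (norm_add_le _ _).trans (add_le_add (h₁ α) (h₂ α))
  | tmul ξ η =>
    obtain ⟨c, ξ, hξ, rfl⟩ := exists_eq_smul_of_norm_le_one ξ
    obtain ⟨c', η, hη, rfl⟩ := exists_eq_smul_of_norm_le_one η
    refine ⟨‖c‖ * ‖c'‖, fun α => ?_⟩
    rw [TensorProduct.smul_tmul_smul, map_smul, norm_smul, norm_mul]
    exact mul_le_mul_of_nonneg_left (norm_tensor_tmul_le hq x hqx π₁ π₂ hξ hη α) (by positivity)

/-! ### The seminorm `‖·‖_m` and its kernel -/

variable (X A B) in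
/-- The semi-norm `‖ ‖_m` as a seminorm. -/
def mSeminorm : Seminorm ℂ (A ⊗[ℂ] B) :=
  ⨆ x : X, (minTensorSeminorm (Fibre A x) (Fibre B x)).comp (fibreTensorMap A B x)

lemma bddAbove_mSeminorm (α : A ⊗[ℂ] B) : BddAbove (Set.range fun x : X =>
    (minTensorSeminorm (Fibre A x) (Fibre B x)).comp (fibreTensorMap A B x) α) := by
  simpa only [Seminorm.comp_apply, minTensorSeminorm_apply] using bddAbove_mNorm α

lemma mSeminorm_apply (α : A ⊗[ℂ] B) : mSeminorm X A B α = mNorm X α := by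
  rw [mSeminorm, Seminorm.iSup_apply (Seminorm.bddAbove_range_iff.2 bddAbove_mSeminorm)]
  simp only [Seminorm.comp_apply, minTensorSeminorm_apply]
  rfl

lemma isCStarSeminorm_mSeminorm : IsCStarSeminorm (mSeminorm X A B) :=
  .iSup (fun x => isCStarSeminorm_minTensorSeminorm.comp _ (fibreTensorMap_mul x)
    (fibreTensorMap_star x)) bddAbove_mSeminorm

lemma mSeminorm_eq_zero_iff {α : A ⊗[ℂ] B} :
    mSeminorm X A B α = 0 ↔ α ∈ (tensorIdeal X A B).toSubmodule := by
  have hle : ∀ x : X, minTensorNorm (fibreTensorMap A B x α) ≤ mSeminorm X A B α := fun x => by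
    rw [mSeminorm_apply]; exact le_ciSup (bddAbove_mNorm α) x
  constructor
  · intro h x
    refine eq_zero_of_minTensorNorm_eq_zero (le_antisymm (h ▸ hle x) ?_)
    rw [← minTensorSeminorm_apply]; exact apply_nonneg _ _
  · intro h
    refine le_antisymm ?_ (apply_nonneg _ _)
    rw [mSeminorm_apply]
    refine Real.iSup_le (fun x => ?_) le_rfl
    rw [← minTensorSeminorm_apply, h x, map_zero]

end CXAlgebra

/-! ### Descent to the quotient -/

/-- The seminorm induced on the quotient by an ideal on which a seminorm vanishes. -/
def StarIdeal.liftSeminorm {D : Type*} [NonUnitalRing D] [StarRing D] [Module ℂ D]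
    (I : StarIdeal D) (p : Seminorm ℂ D) (hp : ∀ a ∈ I.toSubmodule, p a = 0) :
    Seminorm ℂ I.Quotient :=
  have hcongr : ∀ a b, I.proj a = I.proj b → p a = p b := fun a b h => by
    have h1 := abs_sub_map_le_sub p a b
    rw [hp _ (I.proj_eq_proj.1 h)] at h1
    exact sub_eq_zero.1 (abs_nonpos_iff.1 h1)
  have hinv : ∀ z, I.proj (Function.surjInv I.proj_surjective z) = z :=
    Function.surjInv_eq I.proj_surjective
  Seminorm.of (fun z => p (Function.surjInv I.proj_surjective z))
    (fun z w => by
      refine le_of_eq_of_le (hcongr _ _ ?_) (map_add_le_add p _ _)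
      rw [map_add, hinv, hinv, hinv])
    (fun c z => by
      rw [← map_smul_eq_mul]
      refine hcongr _ _ ?_
      rw [map_smul, hinv, hinv])

lemma StarIdeal.liftSeminorm_proj {D : Type*} [NonUnitalRing D] [StarRing D] [Module ℂ D]
    (I : StarIdeal D) (p : Seminorm ℂ D) (hp : ∀ a ∈ I.toSubmodule, p a = 0) (a : D) :
    I.liftSeminorm p hp (I.proj a) = p a := by
  have h1 := abs_sub_map_le_sub p (Function.surjInv I.proj_surjective (I.proj a)) a
  rw [hp _ (I.proj_eq_proj.1 (Function.surjInv_eq I.proj_surjective _))] at h1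
  exact sub_eq_zero.1 (abs_nonpos_iff.1 h1)

end

theorem mainTheorem1 (X : Type*) [TopologicalSpace X] [CompactSpace X] [T2Space X]
    (A₁ : Type*) [NonUnitalCStarAlgebra A₁] [CXAlgebra X A₁]
    (A₂ : Type*) [NonUnitalCStarAlgebra A₂] [CXAlgebra X A₂] :
    ∃ p : Seminorm ℂ (CXAlgebra.tensorIdeal X A₁ A₂).Quotient,
      (∀ α : A₁ ⊗[ℂ] A₂, p ((CXAlgebra.tensorIdeal X A₁ A₂).proj α) = CXAlgebra.mNorm X α) ∧
      IsLeast {q : Seminorm ℂ (CXAlgebra.tensorIdeal X A₁ A₂).Quotient | IsCStarNorm q} p := by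
  set I := CXAlgebra.tensorIdeal X A₁ A₂ with hI
  have hm := CXAlgebra.isCStarSeminorm_mSeminorm (X := X) (A := A₁) (B := A₂)
  let p := I.liftSeminorm (CXAlgebra.mSeminorm X A₁ A₂)
    fun α hα => CXAlgebra.mSeminorm_eq_zero_iff.2 hα
  have hp : ∀ α, p (I.proj α) = CXAlgebra.mSeminorm X A₁ A₂ α := I.liftSeminorm_proj _ _
  refine ⟨p, fun α => by rw [hp, CXAlgebra.mSeminorm_apply], ⟨⟨fun z w => ?_, fun z => ?_⟩,
    fun z hz => ?_⟩, fun q hq z => ?_⟩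
  · obtain ⟨α, rfl⟩ := I.proj_surjective z
    obtain ⟨β, rfl⟩ := I.proj_surjective w
    rw [← I.proj_mul, hp, hp, hp]
    exact hm.mul_le α β
  · obtain ⟨α, rfl⟩ := I.proj_surjective z
    rw [← I.proj_star, ← I.proj_mul, hp, hp]
    exact hm.star_mul_self α
  · obtain ⟨α, rfl⟩ := I.proj_surjective z
    rw [hp, CXAlgebra.mSeminorm_eq_zero_iff] at hz
    rw [← map_zero I.proj, I.proj_eq_proj, sub_zero]
    exact hz
  · obtain ⟨α, rfl⟩ := I.proj_surjective z
    have hq' : IsCStarNorm q := hq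
    have hqI := hq'.toIsCStarSeminorm.comp I.proj I.proj_mul I.proj_star
    rw [hp, CXAlgebra.mSeminorm_apply]
    refine Real.iSup_le (fun x => ?_) (apply_nonneg _ _)
    -- If `q` vanishes at the class of `a ⊗ b`, then `a ⊗ b` lies in `J`; its image at `x` would be
    -- `0`, although both factors are nonzero there.
    refine CXAlgebra.minTensorNorm_fibre_le hqI x (fun a b ha hb h0 => ?_) α
    have h1 := hq'.eq_zero _ h0
    rw [← map_zero I.proj, I.proj_eq_proj, sub_zero] at h1
    exact TensorProduct.tmul_ne_zero_of_ne_zero ha hb (h1 x)
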